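/- Let $T=(V,E)$ be a finite tree with at least two vertices. Let $s\ge 1$, and let each edge $e$ of $T$ carry a real symmetric positive definite $s\times s$ weight matrix $W(e)$. The Laplacian $L(T)$ is the block matrix indexed by $V$ whose $(u,u)$ block is the sum of the weights of the edges at $u$, and whose $(u,v)$ block, for $u\ne v$, is $-W(e)$ if $e=uv$ is an edge and $0$ otherwise. Write $\lambda_1(A)\le\lambda_2(A)\le\cdots$ for the eigenvalues of a real symmetric matrix $A$, counted with multiplicity, and $\rho(A)$ for the spectral radius of $A$. Put $\mu(T)=\lambda_{s+1}(L(T))$. For a vertex $v$, let $M_v=L_v^{-1}$, where $L_v$ is obtained from $L(T)$ by deleting the row block and the column block of $v$. A branch at $v$ is (the vertex set of) a connected component $B$ of $T-v$, and $M_v(B)$ is the inverse of the principal submatrix of $L(T)$ on the blocks of the vertices of $B$. The branch at $v$ containing $u\neq v$ is denoted $B_v(u)$, and $M_v(u)=M_v(B_v(u))$. A branch $B$ at $v$ is a Perron branch if $\rho(M_v(B))=\rho(M_v)$. If there is a unique vertex $v$ at which there are two or more Perron branches, then $v$ is the characteristic-like vertex of $T$. If there is a unique pair of adjacent vertices $u,v$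 such that $B_u(v)$ is the only Perron branch at $u$ and $B_v(u)$ is the only Perron branch at $v$, then the edge $uv$ is the characteristic-like edge of $T$. Define $\kappa(T)$ as follows. If $T$ has a characteristic-like vertex $v$, then $\kappa(T)=1/\rho(M_v)$. If $T$ has a characteristic-like edge $e=uv$, then $$\kappa(T)=\frac1{\rho\big(M_u(v)-\nu\,(J\otimes W(e)^{-1})\big)}=\frac1{\rho\big(M_v(u)-(1-\nu)(J\otimes W(e)^{-1})\big)},$$ where $0<\nu<1$ is such that the two spectral radii are equal, and $J$ denotes the all-ones matrix of the appropriate order. Then $\mu(T)$ is the smallest non-zero eigenvalue of $L(T)$, the constant $\kappa(T)$ is well defined (a value as above exists, and it is unique), and $$\kappa(T)\le\mu(T).$$ -/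

import Mathlib

open scoped Kronecker

noncomputable section

namespace MatrixTree

variable {V : Type*} [Fintype V] [DecidableEq V] {s : ℕ}

/-- The Laplacian `L(G)`, an `ns × ns` block matrix with rows and columns indexed by `V × Fin s`:
the `(u, u)` block is the sum of the weights of the edges at `u`, the `(u, v)` block is `-W(uv)`
if `u ∼ v`, and `0` if `u ≠ v` are not adjacent.  Only the values of `W` on edges are used. -/
def laplacian (G : SimpleGraph V) [DecidableRel G.Adj]
    (W : Sym2 V → Matrix (Fin s) (Fin s) ℝ) : Matrix (V × Fin s) (V × Fin s) ℝ :=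
  Matrix.of fun p q =>
    (if p.1 = q.1 then ∑ w ∈ G.neighborFinset p.1, W s(p.1, w)
      else if G.Adj p.1 q.1 then -W s(p.1, q.1)
      else 0 : Matrix (Fin s) (Fin s) ℝ) p.2 q.2

/-- The principal submatrix of the Laplacian on the row and column blocks of the vertices in `S`. -/
def principalBlock (G : SimpleGraph V) [DecidableRel G.Adj]
    (W : Sym2 V → Matrix (Fin s) (Fin s) ℝ) (S : Finset V) :
    Matrix (S × Fin s) (S × Fin s) ℝ :=
  (laplacian G W).submatrix (fun p => (p.1.1, p.2)) (fun p => (p.1.1, p.2))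

/-- The inverse of the principal submatrix of the Laplacian on `S`.  When `S` is a branch `B` at a
vertex `v` of a tree, this is the bottleneck matrix `M_v(B)` of that branch. -/
def bottleneck (G : SimpleGraph V) [DecidableRel G.Adj]
    (W : Sym2 V → Matrix (Fin s) (Fin s) ℝ) (S : Finset V) :
    Matrix (S × Fin s) (S × Fin s) ℝ :=
  (principalBlock G W S)⁻¹

/-- `M_v = L_v⁻¹`, where `L_v` is the Laplacian without the row and column blocks of `v`. -/
def vertexInverse (G : SimpleGraph V) [DecidableRel G.Adj]
    (W : Sym2 V → Matrix (Fin s) (Fin s) ℝ) (v : V) :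
    Matrix ((({v}ᶜ : Finset V)) × Fin s) ((({v}ᶜ : Finset V)) × Fin s) ℝ :=
  (principalBlock G W {v}ᶜ)⁻¹

/-- `ρ(A)`: the largest modulus of a complex eigenvalue of the real matrix `A`. -/
def specRad {m : Type*} [Fintype m] [DecidableEq m] (A : Matrix m m ℝ) : ℝ :=
  (spectralRadius ℂ (A.map (algebraMap ℝ ℂ))).toReal

open scoped Classical in
/-- `B_v(u)`: the vertex set of the connected component of `G - v` that contains `u`
(empty for `u = v`). -/
def branch (G : SimpleGraph V) (v u : V) : Finset V :=
  Finset.univ.filter fun x => ∃ p : G.Walk u x, v ∉ p.support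

/-- `B` is a branch at `v`, that is, a connected component of `G - v`. -/
def IsBranch (G : SimpleGraph V) (v : V) (B : Finset V) : Prop :=
  ∃ u, u ≠ v ∧ B = branch G v u

/-- `B` is a Perron branch at `v`: a branch whose Perron value `ρ(M_v(B))` equals `ρ(M_v)`. -/
def IsPerronBranch (G : SimpleGraph V) [DecidableRel G.Adj]
    (W : Sym2 V → Matrix (Fin s) (Fin s) ℝ) (v : V) (B : Finset V) : Prop :=
  IsBranch G v B ∧ specRad (bottleneck G W B) = specRad (vertexInverse G W v)

/-- There are two or more Perron branches at `v`. -/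
def HasTwoPerronBranches (G : SimpleGraph V) [DecidableRel G.Adj]
    (W : Sym2 V → Matrix (Fin s) (Fin s) ℝ) (v : V) : Prop :=
  ∃ B₁ B₂, B₁ ≠ B₂ ∧ IsPerronBranch G W v B₁ ∧ IsPerronBranch G W v B₂

/-- `v` is the unique vertex at which there are two or more Perron branches. -/
def IsCharacteristicLikeVertex (G : SimpleGraph V) [DecidableRel G.Adj]
    (W : Sym2 V → Matrix (Fin s) (Fin s) ℝ) (v : V) : Prop :=
  HasTwoPerronBranches G W v ∧ ∀ w, HasTwoPerronBranches G W w → w = v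

/-- `B_v(u)` is the only Perron branch at `v`. -/
def PerronBranchToward (G : SimpleGraph V) [DecidableRel G.Adj]
    (W : Sym2 V → Matrix (Fin s) (Fin s) ℝ) (v u : V) : Prop :=
  ∀ B, IsPerronBranch G W v B ↔ B = branch G v u

/-- `u ∼ v`, the Perron branch at `u` is the branch containing `v`, and the Perron branch at `v`
is the branch containing `u`. -/
def PerronBranchesFacing (G : SimpleGraph V) [DecidableRel G.Adj]
    (W : Sym2 V → Matrix (Fin s) (Fin s) ℝ) (u v : V) : Prop :=
  G.Adj u v ∧ PerronBranchToward G W u v ∧ PerronBranchToward G W v u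

/-- `{u, v}` is the unique pair of adjacent vertices whose Perron branches face each other. -/
def IsCharacteristicLikeEdge (G : SimpleGraph V) [DecidableRel G.Adj]
    (W : Sym2 V → Matrix (Fin s) (Fin s) ℝ) (u v : V) : Prop :=
  PerronBranchesFacing G W u v ∧
    ∀ x y, PerronBranchesFacing G W x y → s(x, y) = s(u, v)

/-- `M_u(v) - t (J ⊗ W(e)⁻¹)`, where `e` is the edge between `u` and `v` and `J` is the all-ones
matrix indexed by the vertices of `B_u(v)`. -/
def shiftedBottleneck (G : SimpleGraph V) [DecidableRel G.Adj]
    (W : Sym2 V → Matrix (Fin s) (Fin s) ℝ) (u v : V) (t : ℝ) :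
    Matrix (branch G u v × Fin s) (branch G u v × Fin s) ℝ :=
  bottleneck G W (branch G u v) -
    t • ((Matrix.of fun _ _ => (1 : ℝ) : Matrix (branch G u v) (branch G u v) ℝ) ⊗ₖ
      (W s(u, v))⁻¹)

/-- `k` is a value of the constant `κ(G)`: either `k = 1 / ρ(M_v)` with `v` the characteristic-like
vertex, or `k = 1 / ρ(M_u(v) - ν (J ⊗ W(e)⁻¹))` with `e = uv` the characteristic-like edge and
`0 < ν < 1` balancing the two spectral radii. -/
def IsKappa (G : SimpleGraph V) [DecidableRel G.Adj]
    (W : Sym2 V → Matrix (Fin s) (Fin s) ℝ) (k : ℝ) : Prop :=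
  (∃ v, IsCharacteristicLikeVertex G W v ∧ k = 1 / specRad (vertexInverse G W v)) ∨
  (∃ u v, IsCharacteristicLikeEdge G W u v ∧
    ∃ ν : ℝ, 0 < ν ∧ ν < 1 ∧
      specRad (shiftedBottleneck G W u v ν) = specRad (shiftedBottleneck G W v u (1 - ν)) ∧
      k = 1 / specRad (shiftedBottleneck G W u v ν))

/-- `λ_k(A)` for a real symmetric matrix `A` of order `N` and `1 ≤ k ≤ N`: the `k`-th smallest
eigenvalue, counted with multiplicity (the default `0` is used only for `k` out of range). -/
def sortedEigenvalue {m : Type*} [Fintype m] [DecidableEq m] (A : Matrix m m ℝ) (k : ℕ) : ℝ :=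
  (A.charpoly.roots.sort (· ≤ ·)).getD (k - 1) 0

/-- `μ(G) = λ_{s+1}(L(G))`. -/
def mu (G : SimpleGraph V) [DecidableRel G.Adj]
    (W : Sym2 V → Matrix (Fin s) (Fin s) ℝ) : ℝ :=
  sortedEigenvalue (laplacian G W) (s + 1)

end MatrixTree

end

/-!
Write `M(S)` for the inverse of the principal block `L_S` of the Laplacian on a vertex set `S ≠ V`.
Everything rests on the variational description of the spectral radius: `L_S` is positive definite
and `1 / ρ(M(S))` is the minimum of the Rayleigh quotient `⟨f, L f⟩ / ⟨f, f⟩` over the vectors `f`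
supported on `S`, where `⟨f, L f⟩` is the energy `∑ (f a - f b)ᵀ W(ab) (f a - f b)` over the edges.
No Perron–Frobenius theorem is available for matrix weights; it is replaced by a unique continuation
property. If a minimizer on a branch vanishes at some vertex `a` of it, then each of its pieces over
the branches at `a` is itself a minimizer, and the eigenvector equation at `a` makes the piece
vanish at the neighbour of `a`; so the minimizer is zero (`eq_zero_of_blockAt_eq_zero`). Hence
`ρ(M(S))` strictly increases when `S` grows to a branch (`specRad_bottleneck_strictMono`).

This yields the dichotomy between vertices and edges. If a Perron branch at `v` misses `w`, the only
Perron branch at `w` is the one towards `v` (`IsPerronBranch.perronBranchToward`), which makes a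
characteristic-like vertex or edge unique. If every vertex has a single Perron branch, a tree having
fewer edges than vertices forces two Perron branches to face each other along an edge
(`exists_hasTwoPerronBranches_or_perronBranchesFacing`).

For an edge `uv`, the matrix `M_u(v) - t (J ⊗ W(uv)⁻¹)` is the bottleneck matrix of the branch after
the resistance `W(uv)⁻¹` of its root edge has been multiplied by `1 - t` (`inv_add_smul_eq`), that
is, after the root has been moved along the edge. Its spectral radius is continuous and antitone
in `t`. For `t = 1` only branches at `v` that avoid `u` are left, so that the radii on the two sides
of a characteristic-like edge cross in its interior (`PerronBranchesFacing.exists_balance`);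
monotonicity makes their common value unique.

Finally, let `f` be an eigenvector of `L` for an eigenvalue `k ≠ 0`. Subtract from it a constant
vector so that it vanishes at the characteristic-like vertex or, after linear interpolation along
the characteristic-like edge, at the balancing point of that edge. This does not change the energy,
does not decrease the norm because `f` is orthogonal to the constants, and leaves a sum of vectors
supported on both sides, to which the variational bound applies: `κ ≤ k`
(`IsKappa.le_of_eigenvector`). Since the kernel of `L` consists of the constant vectors and has
dimension `s`, the eigenvalue `λ_{s+1}` is the least nonzero one (`isLeast_mu`).
-/

namespace MatrixTree

/-! ### Branches of a graph -/

section Branches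

variable {V : Type*} [Fintype V] {G : SimpleGraph V}

theorem mem_branch {v u x : V} : x ∈ branch G v u ↔ ∃ p : G.Walk u x, v ∉ p.support := by
  simp [branch]

theorem notMem_branch_root (v u : V) : v ∉ branch G v u := by
  rw [mem_branch]
  rintro ⟨p, hp⟩
  exact hp p.end_mem_support

theorem mem_branch_self {v u : V} (h : u ≠ v) : u ∈ branch G v u :=
  mem_branch.2 ⟨.nil, by simpa using h.symm⟩

theorem ne_of_mem_branch {v u x : V} (h : x ∈ branch G v u) : x ≠ v := by
  rintro rfl
  exact notMem_branch_root _ _ h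

theorem branch_eq_of_mem {v u x : V} (h : x ∈ branch G v u) : branch G v x = branch G v u := by
  obtain ⟨p, hp⟩ := mem_branch.1 h
  ext y
  simp only [mem_branch]
  constructor
  · rintro ⟨q, hq⟩
    exact ⟨p.append q, by simp [SimpleGraph.Walk.mem_support_append_iff, hp, hq]⟩
  · rintro ⟨q, hq⟩
    exact ⟨p.reverse.append q, by simp [SimpleGraph.Walk.mem_support_append_iff, hp, hq]⟩

theorem mem_branch_of_adj {v u x y : V} (h : x ∈ branch G v u) (hxy : G.Adj x y) (hy : y ≠ v) :
    y ∈ branch G v u := by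
  rw [← branch_eq_of_mem h]
  exact mem_branch.2 ⟨.cons hxy .nil, by
    simpa using ⟨(ne_of_mem_branch h).symm, hy.symm⟩⟩

theorem mem_branch_of_mem_support {v u x y : V} (p : G.Walk u x) (hp : v ∉ p.support)
    (hy : y ∈ p.support) : y ∈ branch G v u := by
  classical
  exact mem_branch.2 ⟨p.takeUntil y hy, fun h => hp (p.support_takeUntil_subset_support hy h)⟩

/-- A property that passes along edges inside a branch and holds somewhere in it holds on all of
it, because a branch is connected. -/
theorem forall_mem_branch_of_adj {v u : V} {P : V → Prop}
    (hstep : ∀ a ∈ branch G v u, ∀ b ∈ branch G v u, G.Adj a b → P a → P b)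
    {a : V} (ha : a ∈ branch G v u) (hPa : P a) : ∀ b ∈ branch G v u, P b := by
  intro b hb
  rw [← branch_eq_of_mem ha] at hb
  obtain ⟨p, hp⟩ := mem_branch.1 hb
  clear hb
  induction p with
  | nil => exact hPa
  | cons h q ih =>
    simp only [SimpleGraph.Walk.support_cons, List.mem_cons, not_or] at hp
    have hc := mem_branch_of_adj ha h
      (fun hv => hp.2 (hv ▸ q.start_mem_support))
    exact ih hc (hstep _ ha _ hc h hPa) hp.2

theorem exists_adj_mem_branch (hG : G.Connected) {v u : V} (h : u ≠ v) :
    ∃ b, G.Adj v b ∧ u ∈ branch G v b := by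
  classical
  obtain ⟨p, hp⟩ := (hG v u).exists_isPath
  cases p with
  | nil => exact absurd rfl h
  | cons hadj q =>
    rw [SimpleGraph.Walk.cons_isPath_iff] at hp
    exact ⟨_, hadj, mem_branch.2 ⟨q, hp.2⟩⟩

theorem IsBranch.exists_adj (hG : G.Connected) {v : V} {B : Finset V} (h : IsBranch G v B) :
    ∃ b, G.Adj v b ∧ B = branch G v b := by
  obtain ⟨u, hu, rfl⟩ := h
  obtain ⟨b, hb, hub⟩ := exists_adj_mem_branch hG hu
  exact ⟨b, hb, branch_eq_of_mem hub⟩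

/-- A branch at `w` that misses `v` lies strictly inside the branch at `v` towards `w`. -/
theorem branch_ssubset_branch (hG : G.Connected) {v w x : V} (hvw : v ≠ w) (hx : x ≠ w)
    (hv : v ∉ branch G w x) : branch G w x ⊂ branch G v w := by
  obtain ⟨b, hb, hxb⟩ := exists_adj_mem_branch hG hx
  rw [branch_eq_of_mem hxb] at hv ⊢
  refine (Finset.ssubset_iff_of_subset fun y hy => ?_).2
    ⟨w, mem_branch_self hvw.symm, notMem_branch_root _ _⟩
  obtain ⟨p, hp⟩ := mem_branch.1 hy
  refine mem_branch.2 ⟨.cons hb p, ?_⟩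
  rw [SimpleGraph.Walk.support_cons, List.mem_cons, not_or]
  exact ⟨hvw, fun h => hv (mem_branch_of_mem_support p hp h)⟩

/-- In an acyclic graph, `v` has a single neighbour in each of its branches. -/
theorem eq_of_adj_of_mem_branch (hG : G.IsAcyclic) {v b w : V} (hb : G.Adj v b) (hw : G.Adj v w)
    (h : w ∈ branch G v b) : w = b := by
  classical
  obtain ⟨p, hp⟩ := mem_branch.1 h
  have h1 : (SimpleGraph.Walk.cons hb p.toPath.1).IsPath := by
    rw [SimpleGraph.Walk.cons_isPath_iff]
    exact ⟨p.toPath.2, fun h => hp (p.support_toPath_subset_support h)⟩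
  have h2 : (SimpleGraph.Walk.cons hw .nil).IsPath := by
    rw [SimpleGraph.Walk.cons_isPath_iff]
    exact ⟨.nil, by simpa using hw.ne⟩
  have h3 := congrArg (fun q : G.Path v w => q.1.length)
    ((hG.subsingleton_path v w).elim ⟨_, h1⟩ ⟨_, h2⟩)
  simp only [SimpleGraph.Walk.length_cons, SimpleGraph.Walk.length_nil] at h3
  exact (SimpleGraph.Walk.eq_of_length_eq_zero (by omega : p.toPath.1.length = 0)).symm

/-- The two branches facing each other along an edge `uv` of an acyclic graph are disjoint: a common
vertex would be joined to `u` by one path through `v` and by another one avoiding `v`. -/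
theorem notMem_branch_of_mem_branch_symm (hG : G.IsAcyclic) {u v x : V} (huv : G.Adj u v)
    (h : x ∈ branch G u v) : x ∉ branch G v u := by
  classical
  intro h'
  obtain ⟨p, hp⟩ := mem_branch.1 h
  obtain ⟨q, hq⟩ := mem_branch.1 h'
  have h1 : (SimpleGraph.Walk.cons huv p.toPath.1).IsPath := by
    rw [SimpleGraph.Walk.cons_isPath_iff]
    exact ⟨p.toPath.2, fun h => hp (p.support_toPath_subset_support h)⟩
  have h3 := congrArg (fun q : G.Path u x => q.1.support)
    ((hG.subsingleton_path u x).elim ⟨_, h1⟩ q.toPath)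
  refine hq (q.support_toPath_subset_support ?_)
  rw [← h3]
  simp

theorem mem_branch_or_mem_branch_symm (hG : G.Connected) {u v : V} (huv : G.Adj u v) (x : V) :
    x ∈ branch G v u ∨ x ∈ branch G u v := by
  classical
  obtain ⟨p, hp⟩ := (hG u x).exists_isPath
  cases p with
  | nil => exact .inl (mem_branch_self huv.ne)
  | cons h q =>
    rw [SimpleGraph.Walk.cons_isPath_iff] at hp
    by_cases hv : v ∈ q.support
    · exact .inr (mem_branch.2 ⟨q.dropUntil v hv, fun hu =>
        hp.2 (q.support_dropUntil_subset_support hv hu)⟩)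
    · exact .inl (mem_branch.2 ⟨.cons h q, by
        rw [SimpleGraph.Walk.support_cons, List.mem_cons, not_or]
        exact ⟨huv.ne', hv⟩⟩)

theorem IsBranch.root_notMem {v : V} {B : Finset V} (h : IsBranch G v B) : v ∉ B := by
  obtain ⟨u, _, rfl⟩ := h
  exact notMem_branch_root v u

theorem IsBranch.nonempty {v : V} {B : Finset V} (h : IsBranch G v B) : B.Nonempty := by
  obtain ⟨u, hu, rfl⟩ := h
  exact ⟨u, mem_branch_self hu⟩

end Branches

/-! ### Spectral radii of symmetric matrices -/

section SpectralRadius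

open Matrix

variable {m : Type*} [Fintype m] [DecidableEq m] {A B : Matrix m m ℝ}

theorem mem_spectrum_map_iff (hA : A.IsHermitian) (k : ℂ) :
    k ∈ spectrum ℂ (A.map (algebraMap ℝ ℂ)) ↔ ∃ i, (hA.eigenvalues i : ℂ) = k := by
  rw [Matrix.mem_spectrum_iff_isRoot_charpoly, Matrix.charpoly_map, hA.charpoly_eq]
  simp [Polynomial.IsRoot, Polynomial.eval_map, Polynomial.eval₂_finsetProd,
    Finset.prod_eq_zero_iff, sub_eq_zero, eq_comm (a := k)]

theorem abs_eigenvalues_le_specRad (hA : A.IsHermitian) (i : m) :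
    |hA.eigenvalues i| ≤ specRad A := by
  -- Finiteness guards against the junk value of `ENNReal.toReal` at `⊤`.
  have hne : spectralRadius ℂ (A.map (algebraMap ℝ ℂ)) ≠ ⊤ := by
    refine ne_top_of_le_ne_top (b := ((∑ j, ‖(hA.eigenvalues j : ℂ)‖₊ : NNReal) : ENNReal))
      ENNReal.coe_ne_top (iSup₂_le fun k hk => ?_)
    obtain ⟨j, rfl⟩ := (mem_spectrum_map_iff hA k).1 hk
    exact ENNReal.coe_le_coe.2 (Finset.single_le_sum (f := fun j => ‖(hA.eigenvalues j : ℂ)‖₊)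
      (fun _ _ => zero_le) (Finset.mem_univ j))
  have h : (‖(hA.eigenvalues i : ℂ)‖₊ : ENNReal) ≤ spectralRadius ℂ (A.map (algebraMap ℝ ℂ)) :=
    le_iSup₂_of_le (f := fun k (_ : k ∈ spectrum ℂ (A.map (algebraMap ℝ ℂ))) => (‖k‖₊ : ENNReal))
      _ ((mem_spectrum_map_iff hA _).2 ⟨i, rfl⟩) le_rfl
  have h2 := ENNReal.toReal_mono hne h
  simpa [specRad] using h2

theorem specRad_nonneg (A : Matrix m m ℝ) : 0 ≤ specRad A := ENNReal.toReal_nonneg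

theorem specRad_le_of_eigenvalues {c : ℝ} (hc : 0 ≤ c) (hA : A.IsHermitian)
    (h : ∀ i, |hA.eigenvalues i| ≤ c) : specRad A ≤ c := by
  refine ENNReal.toReal_le_of_le_ofReal hc (iSup₂_le fun k hk => ?_)
  obtain ⟨j, rfl⟩ := (mem_spectrum_map_iff hA k).1 hk
  have h2 := ENNReal.ofReal_le_ofReal (h j)
  rw [← Real.norm_eq_abs, ofReal_norm] at h2
  refine le_trans (le_of_eq ?_) h2
  rw [enorm_eq_nnnorm]
  congr 1
  ext
  simp

theorem dotProduct_mulVec_le_of_eigen {c : ℝ} (hA : A.IsHermitian)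
    (h : ∀ x k, x ≠ 0 → A *ᵥ x = k • x → k ≤ c) (x : m → ℝ) :
    x ⬝ᵥ A *ᵥ x ≤ c * (x ⬝ᵥ x) := by
  have hH : (c • (1 : Matrix m m ℝ) - A).IsHermitian :=
    IsHermitian.sub (by simp [IsHermitian]) hA
  have hP : (c • (1 : Matrix m m ℝ) - A).PosSemidef := by
    rw [hH.posSemidef_iff_eigenvalues_nonneg]
    intro i
    have h1 := hH.mulVec_eigenvectorBasis i
    have h2 : A *ᵥ ⇑(hH.eigenvectorBasis i) =
        (c - hH.eigenvalues i) • ⇑(hH.eigenvectorBasis i) := by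
      rw [sub_mulVec, smul_mulVec, one_mulVec] at h1
      rw [sub_smul, ← h1, sub_sub_cancel]
    have h3 := h _ _ ((WithLp.ofLp_eq_zero 2).ne.2 (hH.eigenvectorBasis.orthonormal.ne_zero i)) h2
    simpa using h3
  have := hP.dotProduct_mulVec_nonneg x
  simp only [star_trivial, sub_mulVec, smul_mulVec, one_mulVec, dotProduct_sub, dotProduct_smul,
    smul_eq_mul] at this
  linarith

theorem dotProduct_self_pos {ι : Type*} [Fintype ι] {x : ι → ℝ} (hx : x ≠ 0) : 0 < x ⬝ᵥ x := by
  simpa using dotProduct_star_self_pos_iff.2 hx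

theorem eigenvalue_le_of_dotProduct {ι : Type*} [Fintype ι] {A : Matrix ι ι ℝ} {c k : ℝ}
    {x : ι → ℝ} (hx : x ≠ 0) (hk : A *ᵥ x = k • x)
    (h : x ⬝ᵥ A *ᵥ x ≤ c * (x ⬝ᵥ x)) : k ≤ c := by
  rw [hk, dotProduct_smul, smul_eq_mul] at h
  exact le_of_mul_le_mul_right h (dotProduct_self_pos hx)

theorem specRad_le (hA : A.PosSemidef) {c : ℝ} (hc : 0 ≤ c)
    (h : ∀ x, x ⬝ᵥ A *ᵥ x ≤ c * (x ⬝ᵥ x)) : specRad A ≤ c := by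
  refine specRad_le_of_eigenvalues hc hA.1 fun i => ?_
  rw [abs_of_nonneg (hA.eigenvalues_nonneg i)]
  exact eigenvalue_le_of_dotProduct
    ((WithLp.ofLp_eq_zero 2).ne.2 (hA.1.eigenvectorBasis.orthonormal.ne_zero i))
    (hA.1.mulVec_eigenvectorBasis i) (h _)

theorem dotProduct_mulVec_le_specRad (hA : A.IsHermitian) (x : m → ℝ) :
    x ⬝ᵥ A *ᵥ x ≤ specRad A * (x ⬝ᵥ x) := by
  refine dotProduct_mulVec_le_of_eigen hA (fun y k hy hk => ?_) x
  have hmem : k ∈ spectrum ℝ A := by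
    rw [← Matrix.spectrum_toLin']
    exact (Module.End.hasEigenvalue_of_hasEigenvector
      (x := y) ⟨Module.End.mem_eigenspace_iff.2 (by simpa using hk), hy⟩).mem_spectrum
  rw [hA.spectrum_real_eq_range_eigenvalues] at hmem
  obtain ⟨i, rfl⟩ := hmem
  exact (le_abs_self _).trans (abs_eigenvalues_le_specRad hA i)

theorem eigenvalue_le_specRad (hA : A.IsHermitian) {k : ℝ} {x : m → ℝ} (hx : x ≠ 0)
    (hk : A *ᵥ x = k • x) : k ≤ specRad A :=
  eigenvalue_le_of_dotProduct hx hk (dotProduct_mulVec_le_specRad hA x)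

theorem exists_mulVec_eq_specRad_smul [Nonempty m] (hA : A.PosSemidef) :
    ∃ x, x ≠ 0 ∧ A *ᵥ x = specRad A • x := by
  obtain ⟨i, hi⟩ := Finite.exists_max hA.1.eigenvalues
  have h : specRad A = hA.1.eigenvalues i := by
    refine le_antisymm (specRad_le_of_eigenvalues (hA.eigenvalues_nonneg i) hA.1 fun j => ?_)
      ((le_abs_self _).trans (abs_eigenvalues_le_specRad hA.1 i))
    rw [abs_of_nonneg (hA.eigenvalues_nonneg j)]
    exact hi j
  exact ⟨_, (WithLp.ofLp_eq_zero 2).ne.2 (hA.1.eigenvectorBasis.orthonormal.ne_zero i),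
    h ▸ hA.1.mulVec_eigenvectorBasis i⟩

theorem specRad_mono (hA : A.PosSemidef) (hB : B.IsHermitian)
    (h : ∀ x, x ⬝ᵥ A *ᵥ x ≤ x ⬝ᵥ B *ᵥ x) : specRad A ≤ specRad B :=
  specRad_le hA (specRad_nonneg B) fun x => (h x).trans (dotProduct_mulVec_le_specRad hB x)

/-- Along a segment of positive semidefinite matrices the spectral radius is Lipschitz, hence
continuous. -/
theorem continuousOn_specRad_sub_smul {S : Set ℝ} (hB : B.PosSemidef)
    (hS : ∀ t ∈ S, (A - t • B).PosSemidef) : ContinuousOn (fun t => specRad (A - t • B)) S := by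
  refine (LipschitzOnWith.of_le_add_mul (Real.toNNReal (specRad B))
    fun t ht r hr => ?_).continuousOn
  rw [Real.coe_toNNReal _ (specRad_nonneg B), Real.dist_eq]
  refine specRad_le (hS t ht)
    (add_nonneg (specRad_nonneg _) (mul_nonneg (specRad_nonneg _) (abs_nonneg _))) fun x => ?_
  have h1 := dotProduct_mulVec_le_specRad (hS r hr).1 x
  have h2 := dotProduct_mulVec_le_specRad hB.1 x
  have h3 : 0 ≤ x ⬝ᵥ B *ᵥ x := by simpa using hB.dotProduct_mulVec_nonneg x
  have h4 : (r - t) * (x ⬝ᵥ B *ᵥ x) ≤ |t - r| * (specRad B * (x ⬝ᵥ x)) := by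
    refine (mul_le_mul_of_nonneg_right ?_ h3).trans (mul_le_mul_of_nonneg_left h2 (abs_nonneg _))
    rw [abs_sub_comm]
    exact le_abs_self _
  simp only [sub_mulVec, smul_mulVec, dotProduct_sub, dotProduct_smul, smul_eq_mul] at h1 ⊢
  linarith

theorem antitoneOn_specRad_sub_smul {S : Set ℝ} (hB : B.PosSemidef)
    (hS : ∀ t ∈ S, (A - t • B).PosSemidef) : AntitoneOn (fun t => specRad (A - t • B)) S := by
  intro t ht r hr htr
  refine specRad_mono (hS r hr) (hS t ht).1 fun x => ?_
  have h3 : 0 ≤ x ⬝ᵥ B *ᵥ x := by simpa using hB.dotProduct_mulVec_nonneg x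
  simp only [sub_mulVec, smul_mulVec, dotProduct_sub, dotProduct_smul, smul_eq_mul]
  nlinarith

theorem specRad_inv_pos [Nonempty m] (hA : A.PosDef) : 0 < specRad A⁻¹ := by
  obtain ⟨x, hx, hk⟩ := exists_mulVec_eq_specRad_smul hA.inv.posSemidef
  have h := hA.inv.dotProduct_mulVec_pos hx
  rw [hk, star_trivial, dotProduct_smul, smul_eq_mul] at h
  exact pos_of_mul_pos_left h (dotProduct_self_pos hx).le

theorem inv_mulVec_eq_smul_iff (hA : A.PosDef) {k : ℝ} {x : m → ℝ} :
    A⁻¹ *ᵥ x = k • x ↔ k • A *ᵥ x = x := by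
  have hu := (Matrix.isUnit_iff_isUnit_det _).1 hA.isUnit
  constructor
  · intro h
    rw [← mulVec_smul, ← h, mulVec_mulVec, Matrix.mul_nonsing_inv _ hu, one_mulVec]
  · intro h
    nth_rw 1 [← h]
    rw [mulVec_smul, mulVec_mulVec, Matrix.nonsing_inv_mul _ hu, one_mulVec]

theorem exists_specRad_inv_smul_mulVec_eq [Nonempty m] (hA : A.PosDef) :
    ∃ x, x ≠ 0 ∧ specRad A⁻¹ • A *ᵥ x = x := by
  obtain ⟨x, hx, hk⟩ := exists_mulVec_eq_specRad_smul hA.inv.posSemidef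
  exact ⟨x, hx, (inv_mulVec_eq_smul_iff hA).1 hk⟩

/-- The Rayleigh quotient of a positive definite matrix `A` is at least `1 / ρ(A⁻¹)`. -/
theorem dotProduct_self_le_specRad_inv_mul (hA : A.PosDef) (x : m → ℝ) :
    x ⬝ᵥ x ≤ specRad A⁻¹ * (x ⬝ᵥ A *ᵥ x) := by
  cases isEmpty_or_nonempty m
  · simp [dotProduct]
  have hρ := specRad_inv_pos hA
  have h := dotProduct_mulVec_le_of_eigen (A := -A) (c := -(specRad A⁻¹)⁻¹) hA.1.neg
    (fun y k hy hk => ?_) x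
  · rw [neg_mulVec, dotProduct_neg] at h
    have h2 : (specRad A⁻¹)⁻¹ * (x ⬝ᵥ x) ≤ x ⬝ᵥ A *ᵥ x := by linarith
    rwa [inv_mul_le_iff₀ hρ] at h2
  · have hk' : A *ᵥ y = (-k) • y := by
      rw [neg_smul, ← hk, neg_mulVec, neg_neg]
    have hkpos : 0 < -k := by
      have h := hA.dotProduct_mulVec_pos hy
      rw [hk', star_trivial, dotProduct_smul, smul_eq_mul] at h
      exact pos_of_mul_pos_left h (dotProduct_self_pos hy).le
    have h3 : A⁻¹ *ᵥ y = (-k)⁻¹ • y := by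
      rw [inv_mulVec_eq_smul_iff hA, hk', smul_smul, inv_mul_cancel₀ hkpos.ne', one_smul]
    have h4 := eigenvalue_le_specRad hA.inv.1 hy h3
    have h5 := inv_le_of_inv_le₀ hkpos h4
    linarith

/-- Minimizers of the Rayleigh quotient of `A` are eigenvectors. -/
theorem specRad_inv_smul_mulVec_eq (hA : A.PosDef) {x : m → ℝ}
    (hx : specRad A⁻¹ * (x ⬝ᵥ A *ᵥ x) ≤ x ⬝ᵥ x) : specRad A⁻¹ • A *ᵥ x = x := by
  -- A vector on which a positive semidefinite form vanishes lies in the kernel of its matrix.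
  have hP : (specRad A⁻¹ • A - 1).PosSemidef := by
    refine PosSemidef.of_dotProduct_mulVec_nonneg (IsHermitian.sub ?_ isHermitian_one) fun y => ?_
    · rw [IsHermitian, conjTranspose_smul, hA.1.eq, star_trivial]
    · have := dotProduct_self_le_specRad_inv_mul hA y
      simp only [star_trivial, sub_mulVec, smul_mulVec, one_mulVec, dotProduct_sub,
        dotProduct_smul, smul_eq_mul]
      linarith
  have h0 : star x ⬝ᵥ (specRad A⁻¹ • A - 1) *ᵥ x = 0 := by
    have := dotProduct_self_le_specRad_inv_mul hA x
    simp only [star_trivial, sub_mulVec, smul_mulVec, one_mulVec, dotProduct_sub,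
        dotProduct_smul, smul_eq_mul]
    linarith
  have := (hP.dotProduct_mulVec_zero_iff x).1 h0
  rwa [sub_mulVec, smul_mulVec, one_mulVec, sub_eq_zero] at this

end SpectralRadius

/-! ### Vectors over sets of vertices -/

section Vectors

open Matrix

variable {V : Type*} {s : ℕ}

/-- The value `f(a) ∈ ℝˢ` at the vertex `a` of a vector `f` indexed by `V × Fin s`. -/
def blockAt (f : V × Fin s → ℝ) (a : V) : Fin s → ℝ := fun i => f (a, i)

/-- The vector that is constantly `c ∈ ℝˢ` on the vertices. -/
def constVec (c : Fin s → ℝ) : V × Fin s → ℝ := fun p => c p.2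

/-- `f` vanishes outside the vertex set `S`. -/
def SupportedOn (S : Finset V) (f : V × Fin s → ℝ) : Prop := ∀ p : V × Fin s, p.1 ∉ S → f p = 0

/-- The restriction of `f` to the coordinates over `S`. -/
def restrictTo (S : Finset V) (f : V × Fin s → ℝ) : S × Fin s → ℝ := fun p => f (p.1.1, p.2)

theorem SupportedOn.mono {S S' : Finset V} (h : S ⊆ S') {f : V × Fin s → ℝ}
    (hf : SupportedOn S f) : SupportedOn S' f := fun p hp => hf p fun h' => hp (h h')

theorem SupportedOn.blockAt_eq_zero {S : Finset V} {f : V × Fin s → ℝ} (hf : SupportedOn S f)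
    {a : V} (ha : a ∉ S) : blockAt f a = 0 := funext fun i => hf (a, i) ha

theorem nonempty_prod_fin (hs : 1 ≤ s) {S : Finset V} (hS : S.Nonempty) :
    Nonempty (S × Fin s) :=
  ⟨⟨⟨hS.choose, hS.choose_spec⟩, ⟨0, hs⟩⟩⟩

section DecidableEq

variable [DecidableEq V]

/-- The vector that agrees with `f` over `S` and vanishes elsewhere. -/
def cut (S : Finset V) (f : V × Fin s → ℝ) : V × Fin s → ℝ := fun p => if p.1 ∈ S then f p else 0

/-- Extension by zero of a vector indexed by `S × Fin s`. -/
def extendZero (S : Finset V) (g : S × Fin s → ℝ) : V × Fin s → ℝ :=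
  fun p => if h : p.1 ∈ S then g (⟨p.1, h⟩, p.2) else 0

theorem supportedOn_cut (S : Finset V) (f : V × Fin s → ℝ) : SupportedOn S (cut S f) :=
  fun p hp => by simp [cut, hp]

theorem supportedOn_extendZero (S : Finset V) (g : S × Fin s → ℝ) :
    SupportedOn S (extendZero S g) := fun p hp => by simp [extendZero, hp]

theorem restrictTo_extendZero (S : Finset V) (g : S × Fin s → ℝ) :
    restrictTo S (extendZero S g) = g := by
  ext p; simp [restrictTo, extendZero]

theorem blockAt_cut (S : Finset V) (f : V × Fin s → ℝ) (a : V) :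
    blockAt (cut S f) a = if a ∈ S then blockAt f a else 0 := by
  ext i; by_cases h : a ∈ S <;> simp [blockAt, cut, h]

end DecidableEq

variable [Fintype V]

theorem dotProduct_eq_sum_blockAt (f g : V × Fin s → ℝ) :
    f ⬝ᵥ g = ∑ a, blockAt f a ⬝ᵥ blockAt g a := by
  simp [dotProduct, Fintype.sum_prod_type, blockAt]

theorem sum_restrictTo {S : Finset V} {F : V × Fin s → ℝ} (hF : SupportedOn S F) :
    ∑ p : S × Fin s, F (p.1.1, p.2) = ∑ p, F p := by
  rw [Fintype.sum_prod_type, Fintype.sum_prod_type,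
    Finset.sum_coe_sort S (fun a => ∑ i, F (a, i))]
  refine Finset.sum_subset (Finset.subset_univ S) fun a _ ha => ?_
  exact Finset.sum_eq_zero fun i _ => hF (a, i) ha

theorem SupportedOn.restrictTo_dotProduct {S : Finset V} {f : V × Fin s → ℝ}
    (hf : SupportedOn S f) (g : V × Fin s → ℝ) : restrictTo S f ⬝ᵥ restrictTo S g = f ⬝ᵥ g :=
  sum_restrictTo (F := fun p => f p * g p) fun p hp => by
    simp [hf p hp]

theorem SupportedOn.dotProduct_congr_right {S : Finset V} {f g h : V × Fin s → ℝ}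
    (hf : SupportedOn S f) (hg : ∀ p : V × Fin s, p.1 ∈ S → g p = h p) : f ⬝ᵥ g = f ⬝ᵥ h := by
  refine Finset.sum_congr rfl fun p _ => ?_
  by_cases hp : p.1 ∈ S
  · rw [hg p hp]
  · rw [hf p hp, zero_mul, zero_mul]

end Vectors

/-! ### The Laplacian -/

section Laplacian

open Matrix

variable {V : Type*} [Fintype V] [DecidableEq V] {s : ℕ} {G : SimpleGraph V} [DecidableRel G.Adj]
  {W : Sym2 V → Matrix (Fin s) (Fin s) ℝ}

theorem laplacian_mulVec (f : V × Fin s → ℝ) (a : V) (i : Fin s) :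
    (laplacian G W *ᵥ f) (a, i) =
      (∑ w ∈ G.neighborFinset a, W s(a, w) *ᵥ (blockAt f a - blockAt f w)) i := by
  -- As `G` has no loops, each entry splits into a degree part and an adjacency part.
  have h1 : ∀ b j, laplacian G W (a, i) (b, j) =
      (if a = b then (∑ w ∈ G.neighborFinset a, W s(a, w)) i j else 0) -
        (if G.Adj a b then W s(a, b) i j else 0) := by
    intro b j
    by_cases hab : a = b
    · subst hab; simp [laplacian]
    · by_cases h : G.Adj a b <;> simp [laplacian, hab, h]
  simp only [mulVec, dotProduct, Fintype.sum_prod_type, h1, sub_mul, Finset.sum_sub_distrib,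
    ite_mul, zero_mul]
  rw [Finset.sum_apply]
  simp only [mulVec, dotProduct, Pi.sub_apply, mul_sub, Finset.sum_sub_distrib, blockAt]
  congr 1
  · rw [Finset.sum_comm]
    simp only [Finset.sum_ite_eq, Finset.mem_univ, if_true]
    rw [Finset.sum_comm]
    refine Finset.sum_congr rfl fun j _ => ?_
    rw [Matrix.sum_apply, Finset.sum_mul]
  · rw [SimpleGraph.neighborFinset_eq_filter, Finset.sum_filter]
    refine Finset.sum_congr rfl fun b _ => ?_
    split_ifs <;> simp

theorem blockAt_laplacian_mulVec (f : V × Fin s → ℝ) (a : V) :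
    blockAt (laplacian G W *ᵥ f) a =
      ∑ w ∈ G.neighborFinset a, W s(a, w) *ᵥ (blockAt f a - blockAt f w) :=
  funext fun i => laplacian_mulVec f a i

/-- `⟨f, L f⟩` is the energy of `f`; the double sum meets every edge twice. -/
theorem two_mul_dotProduct_laplacian_mulVec (f : V × Fin s → ℝ) :
    2 * (f ⬝ᵥ laplacian G W *ᵥ f) = ∑ a, ∑ w ∈ G.neighborFinset a,
      (blockAt f a - blockAt f w) ⬝ᵥ W s(a, w) *ᵥ (blockAt f a - blockAt f w) := by
  have h1 : f ⬝ᵥ laplacian G W *ᵥ f = ∑ a, ∑ w ∈ G.neighborFinset a,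
      blockAt f a ⬝ᵥ W s(a, w) *ᵥ (blockAt f a - blockAt f w) := by
    simp only [dotProduct_eq_sum_blockAt, blockAt_laplacian_mulVec, dotProduct_sum]
  have h2 : f ⬝ᵥ laplacian G W *ᵥ f = ∑ a, ∑ w ∈ G.neighborFinset a,
      -(blockAt f w ⬝ᵥ W s(a, w) *ᵥ (blockAt f a - blockAt f w)) := by
    rw [h1]
    simp only [SimpleGraph.neighborFinset_eq_filter, Finset.sum_filter]
    rw [Finset.sum_comm]
    refine Finset.sum_congr rfl fun a _ => Finset.sum_congr rfl fun b _ => ?_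
    simp only [G.adj_comm b a, Sym2.eq_swap (a := b), ← dotProduct_neg, ← mulVec_neg, neg_sub]
  rw [two_mul]
  nth_rw 1 [h1]
  rw [h2, ← Finset.sum_add_distrib]
  refine Finset.sum_congr rfl fun a _ => ?_
  rw [← Finset.sum_add_distrib]
  refine Finset.sum_congr rfl fun b _ => ?_
  rw [sub_dotProduct, sub_eq_add_neg (_ ⬝ᵥ _)]

theorem isHermitian_laplacian (hW : ∀ e ∈ G.edgeSet, (W e).IsHermitian) :
    (laplacian G W).IsHermitian := by
  ext ⟨a, i⟩ ⟨b, j⟩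
  have hsymm : ∀ c d, G.Adj c d → ∀ k l, W s(c, d) k l = W s(c, d) l k := fun c d h k l => by
    simpa using (hW s(c, d) h).apply l k
  rw [conjTranspose_apply, star_trivial]
  by_cases hab : a = b
  · subst hab
    simp only [laplacian, of_apply, if_true, Matrix.sum_apply]
    exact Finset.sum_congr rfl fun w hw => hsymm a w (by simpa using hw) j i
  · by_cases h : G.Adj a b
    · simp [laplacian, hab, Ne.symm hab, h, h.symm, hsymm a b h j i, Sym2.eq_swap (a := b)]
    · have h' : ¬ G.Adj b a := fun h' => h h'.symm
      simp [laplacian, hab, Ne.symm hab, h, h']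

theorem posSemidef_laplacian (hW : ∀ e ∈ G.edgeSet, (W e).PosDef) :
    (laplacian G W).PosSemidef := by
  refine PosSemidef.of_dotProduct_mulVec_nonneg
    (isHermitian_laplacian fun e he => (hW e he).1) fun f => ?_
  have h : 0 ≤ 2 * (f ⬝ᵥ laplacian G W *ᵥ f) := by
    rw [two_mul_dotProduct_laplacian_mulVec]
    refine Finset.sum_nonneg fun a _ => Finset.sum_nonneg fun b hb => ?_
    simpa using (hW s(a, b) (by simpa using hb)).posSemidef.dotProduct_mulVec_nonneg
      (blockAt f a - blockAt f b)
  simpa using h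

theorem blockAt_eq_of_dotProduct_laplacian_eq_zero (hG : G.Connected)
    (hW : ∀ e ∈ G.edgeSet, (W e).PosDef) {f : V × Fin s → ℝ}
    (hf : f ⬝ᵥ laplacian G W *ᵥ f = 0) (a b : V) : blockAt f a = blockAt f b := by
  have hnn : ∀ a, ∀ b ∈ G.neighborFinset a, 0 ≤
      (blockAt f a - blockAt f b) ⬝ᵥ W s(a, b) *ᵥ (blockAt f a - blockAt f b) := fun a b hb => by
    simpa using (hW s(a, b) (by simpa using hb)).posSemidef.dotProduct_mulVec_nonneg
      (blockAt f a - blockAt f b)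
  have hadj : ∀ a b, G.Adj a b → blockAt f a = blockAt f b := by
    intro a b hab
    have h := two_mul_dotProduct_laplacian_mulVec (G := G) (W := W) f
    rw [hf, mul_zero, eq_comm, Finset.sum_eq_zero_iff_of_nonneg
      fun a _ => Finset.sum_nonneg (hnn a)] at h
    have h2 := (Finset.sum_eq_zero_iff_of_nonneg (hnn a)).1 (h a (Finset.mem_univ _)) b
      (by simpa using hab)
    by_contra hne
    have h3 := (hW s(a, b) hab).dotProduct_mulVec_pos (sub_ne_zero.2 hne)
    rw [star_trivial, h2] at h3
    exact lt_irrefl _ h3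
  obtain ⟨p⟩ := hG.preconnected a b
  induction p with
  | nil => rfl
  | cons h _ ih => rw [hadj _ _ h, ih]

theorem laplacian_mulVec_sub_constVec (f : V × Fin s → ℝ) (c : Fin s → ℝ) :
    laplacian G W *ᵥ (f - constVec c) = laplacian G W *ᵥ f := by
  ext ⟨a, i⟩
  rw [laplacian_mulVec, laplacian_mulVec]
  have : ∀ a, blockAt (f - constVec c) a = blockAt f a - c := fun a => rfl
  simp only [this, sub_sub_sub_cancel_right]

theorem laplacian_mulVec_constVec (c : Fin s → ℝ) :
    laplacian G W *ᵥ (constVec c) = 0 := by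
  ext ⟨a, i⟩
  rw [laplacian_mulVec]
  have : ∀ a : V, blockAt (constVec c) a = c := fun a => rfl
  simp [this]

theorem dotProduct_laplacian_mulVec_comm (hW : ∀ e ∈ G.edgeSet, (W e).PosDef)
    (f g : V × Fin s → ℝ) : f ⬝ᵥ laplacian G W *ᵥ g = g ⬝ᵥ laplacian G W *ᵥ f := by
  have h := (posSemidef_laplacian hW).1.eq
  rw [dotProduct_mulVec, ← mulVec_transpose, dotProduct_comm]
  rw [conjTranspose_eq_transpose_of_trivial] at h
  rw [h]

theorem SupportedOn.principalBlock_mulVec {S : Finset V} {f : V × Fin s → ℝ}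
    (hf : SupportedOn S f) :
    principalBlock G W S *ᵥ restrictTo S f = restrictTo S (laplacian G W *ᵥ f) := by
  ext p
  exact sum_restrictTo (F := fun q => laplacian G W (p.1.1, p.2) q * f q)
    fun q hq => by simp [hf q hq]

/-- A vector supported on `S ≠ V` without energy is constant on the connected graph `G`, so it
vanishes. -/
theorem posDef_principalBlock (hG : G.Connected) (hW : ∀ e ∈ G.edgeSet, (W e).PosDef)
    {S : Finset V} {v : V} (hv : v ∉ S) : (principalBlock G W S).PosDef := by
  have hH : (principalBlock G W S).IsHermitian :=
    (posSemidef_laplacian hW).1.submatrix _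
  refine PosDef.of_dotProduct_mulVec_pos hH fun {g} hg => ?_
  have hs := supportedOn_extendZero S g
  rw [star_trivial, ← restrictTo_extendZero S g, hs.principalBlock_mulVec,
    hs.restrictTo_dotProduct]
  have h0 := (posSemidef_laplacian hW).dotProduct_mulVec_nonneg (extendZero S g)
  rw [star_trivial] at h0
  refine lt_of_le_of_ne h0 fun h => hg ?_
  rw [← restrictTo_extendZero S g]
  ext p
  have h1 := blockAt_eq_of_dotProduct_laplacian_eq_zero hG hW h.symm p.1.1 v
  rw [hs.blockAt_eq_zero hv] at h1
  exact congrFun h1 p.2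

end Laplacian

/-! ### Rayleigh quotients on vertex sets -/

section Perron

open Matrix

variable {V : Type*} [Fintype V] [DecidableEq V] {s : ℕ} {G : SimpleGraph V} [DecidableRel G.Adj]
  {W : Sym2 V → Matrix (Fin s) (Fin s) ℝ}

/-- The Rayleigh quotient of a vector supported on `S` is at least `1 / ρ(L_S⁻¹)`. -/
theorem SupportedOn.dotProduct_self_le (hG : G.Connected) (hW : ∀ e ∈ G.edgeSet, (W e).PosDef)
    {S : Finset V} {v : V} (hv : v ∉ S) {f : V × Fin s → ℝ} (hf : SupportedOn S f) :
    f ⬝ᵥ f ≤ specRad (bottleneck G W S) * (f ⬝ᵥ laplacian G W *ᵥ f) := by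
  have h := dotProduct_self_le_specRad_inv_mul (posDef_principalBlock hG hW hv) (restrictTo S f)
  rwa [hf.principalBlock_mulVec, hf.restrictTo_dotProduct, hf.restrictTo_dotProduct] at h

/-- A minimizer of the Rayleigh quotient over `S` solves the eigenvector equation at the vertices
of `S`. -/
theorem SupportedOn.specRad_mul_laplacian_mulVec_eq (hG : G.Connected)
    (hW : ∀ e ∈ G.edgeSet, (W e).PosDef) {S : Finset V} {v : V} (hv : v ∉ S)
    {f : V × Fin s → ℝ} (hf : SupportedOn S f)
    (h : specRad (bottleneck G W S) * (f ⬝ᵥ laplacian G W *ᵥ f) ≤ f ⬝ᵥ f) :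
    ∀ p : V × Fin s, p.1 ∈ S →
      specRad (bottleneck G W S) * (laplacian G W *ᵥ f) p = f p := by
  intro p hp
  rw [← hf.restrictTo_dotProduct, ← hf.restrictTo_dotProduct, ← hf.principalBlock_mulVec] at h
  have h1 := specRad_inv_smul_mulVec_eq (posDef_principalBlock hG hW hv) h
  rw [hf.principalBlock_mulVec] at h1
  exact congrFun h1 (⟨p.1, hp⟩, p.2)

theorem specRad_bottleneck_pos (hG : G.Connected) (hW : ∀ e ∈ G.edgeSet, (W e).PosDef)
    (hs : 1 ≤ s) {S : Finset V} (hS : S.Nonempty) {v : V} (hv : v ∉ S) :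
    0 < specRad (bottleneck G W S) :=
  have := nonempty_prod_fin hs hS
  specRad_inv_pos (posDef_principalBlock hG hW hv)

theorem exists_supportedOn_eigenvector (hG : G.Connected) (hW : ∀ e ∈ G.edgeSet, (W e).PosDef)
    (hs : 1 ≤ s) {S : Finset V} (hS : S.Nonempty) {v : V} (hv : v ∉ S) :
    ∃ f : V × Fin s → ℝ, f ≠ 0 ∧ SupportedOn S f ∧
      specRad (bottleneck G W S) * (f ⬝ᵥ laplacian G W *ᵥ f) = f ⬝ᵥ f := by
  have := nonempty_prod_fin hs hS
  obtain ⟨g, hg0, hg⟩ := exists_specRad_inv_smul_mulVec_eq (posDef_principalBlock hG hW hv)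
  have hf := supportedOn_extendZero S g
  refine ⟨extendZero S g, fun h => hg0 ?_, hf, ?_⟩
  · rw [← restrictTo_extendZero S g, h]
    rfl
  · rw [← hf.restrictTo_dotProduct, ← hf.restrictTo_dotProduct, ← hf.principalBlock_mulVec,
      restrictTo_extendZero, ← smul_eq_mul, ← dotProduct_smul]
    exact congrArg _ hg

theorem SupportedOn.le_specRad_bottleneck (hG : G.Connected)
    (hW : ∀ e ∈ G.edgeSet, (W e).PosDef) {S : Finset V} {v : V} (hv : v ∉ S)
    {f : V × Fin s → ℝ} (hf : SupportedOn S f) (h0 : f ≠ 0) {c : ℝ}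
    (h : c * (f ⬝ᵥ laplacian G W *ᵥ f) ≤ f ⬝ᵥ f) : c ≤ specRad (bottleneck G W S) := by
  have h1 := hf.dotProduct_self_le hG hW hv
  have h2 : 0 ≤ f ⬝ᵥ laplacian G W *ᵥ f := by
    simpa using (posSemidef_laplacian hW).dotProduct_mulVec_nonneg f
  have h3 : 0 < f ⬝ᵥ laplacian G W *ᵥ f := by
    refine lt_of_le_of_ne h2 fun h => ?_
    rw [← h, mul_zero] at h1
    exact absurd h1 (dotProduct_self_pos h0).not_ge
  exact le_of_mul_le_mul_right (h.trans h1) h3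

theorem specRad_bottleneck_mono (hG : G.Connected) (hW : ∀ e ∈ G.edgeSet, (W e).PosDef)
    (hs : 1 ≤ s) {S S' : Finset V} (hS : S.Nonempty) (hSS : S ⊆ S') {v : V} (hv : v ∉ S') :
    specRad (bottleneck G W S) ≤ specRad (bottleneck G W S') := by
  obtain ⟨f, h0, hf, h⟩ := exists_supportedOn_eigenvector hG hW hs hS (fun h => hv (hSS h))
  exact (hf.mono hSS).le_specRad_bottleneck hG hW hv h0 h.le

/-! ### Cutting vectors along the branches at a vertex -/

/-- A vector vanishing at `v` can be cut down to a branch at `v` without changing the value of the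
Laplacian on that branch, since no edge joins two branches. -/
theorem laplacian_mulVec_cut_branch_of_mem {v u : V} {f : V × Fin s → ℝ}
    (hf : blockAt f v = 0) {p : V × Fin s} (hp : p.1 ∈ branch G v u) :
    (laplacian G W *ᵥ cut (branch G v u) f) p = (laplacian G W *ᵥ f) p := by
  obtain ⟨a, i⟩ := p
  rw [laplacian_mulVec, laplacian_mulVec]
  refine congrFun (Finset.sum_congr rfl fun w hw => ?_) i
  rw [blockAt_cut, blockAt_cut, if_pos hp]
  by_cases hwv : w = v
  · rw [hwv, if_neg (notMem_branch_root v u), hf]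
  · rw [if_pos (mem_branch_of_adj hp (by simpa using hw) hwv)]

theorem laplacian_mulVec_cut_branch_of_notMem {v u : V} (f : V × Fin s → ℝ) {a : V}
    (ha : a ∉ branch G v u) (hav : a ≠ v) (i : Fin s) :
    (laplacian G W *ᵥ cut (branch G v u) f) (a, i) = 0 := by
  rw [laplacian_mulVec, Finset.sum_eq_zero, Pi.zero_apply]
  intro w hw
  rw [blockAt_cut, blockAt_cut, if_neg ha, if_neg, sub_zero, mulVec_zero]
  exact fun h => ha (mem_branch_of_adj h (SimpleGraph.Adj.symm (by simpa using hw)) hav)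

/-- In a tree, a single edge joins `v` to each of its branches. -/
theorem laplacian_mulVec_cut_branch_root (hG : G.IsAcyclic) {v b : V} (hvb : G.Adj v b)
    (f : V × Fin s → ℝ) (i : Fin s) :
    (laplacian G W *ᵥ cut (branch G v b) f) (v, i) = -(W s(v, b) *ᵥ blockAt f b) i := by
  rw [laplacian_mulVec, Finset.sum_eq_single b]
  · rw [blockAt_cut, blockAt_cut, if_neg (notMem_branch_root v b),
      if_pos (mem_branch_self hvb.ne'), zero_sub, mulVec_neg, Pi.neg_apply]
  · intro w hw hwb
    rw [blockAt_cut, blockAt_cut, if_neg (notMem_branch_root v b), if_neg, sub_zero, mulVec_zero]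
    exact fun h => hwb (eq_of_adj_of_mem_branch hG hvb (by simpa using hw) h)
  · intro h
    exact absurd (by simpa using hvb) h

/-- A vector that vanishes at `v` and solves the eigenvector equation on a branch at `v` still
solves it on that branch after being cut down to it. -/
theorem mul_dotProduct_laplacian_cut_branch {v u : V} {f : V × Fin s → ℝ} {c : ℝ}
    (hv : blockAt f v = 0)
    (h : ∀ p : V × Fin s, p.1 ∈ branch G v u → f p ≠ 0 → c * (laplacian G W *ᵥ f) p = f p) :
    c * (cut (branch G v u) f ⬝ᵥ laplacian G W *ᵥ cut (branch G v u) f) =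
      cut (branch G v u) f ⬝ᵥ cut (branch G v u) f := by
  rw [(supportedOn_cut _ f).dotProduct_congr_right
    fun p hp => laplacian_mulVec_cut_branch_of_mem (W := W) hv hp, ← smul_eq_mul,
    ← dotProduct_smul]
  refine Finset.sum_congr rfl fun p _ => ?_
  by_cases hp : p.1 ∈ branch G v u
  · by_cases hfp : f p = 0
    · simp [cut, hp, hfp]
    · simp [cut, hp, h p hp hfp]
  · simp [cut, hp]

/-- A nonzero minimizer of the Rayleigh quotient on a branch vanishes at no vertex of the branch.
If it vanished at `a`, each of its pieces over the branches at `a` would be a minimizer as well,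
and the eigenvector equation at `a` would force these pieces to vanish next to `a`. -/
theorem eq_zero_of_blockAt_eq_zero (hG : G.IsTree) (hW : ∀ e ∈ G.edgeSet, (W e).PosDef)
    (hs : 1 ≤ s) {v u : V} {f : V × Fin s → ℝ} (hf : SupportedOn (branch G v u) f)
    (h : specRad (bottleneck G W (branch G v u)) * (f ⬝ᵥ laplacian G W *ᵥ f) ≤ f ⬝ᵥ f)
    {a : V} (ha : a ∈ branch G v u) (hfa : blockAt f a = 0) : f = 0 := by
  set S := branch G v u with hS
  set ρ := specRad (bottleneck G W S) with hρ
  have hvS : v ∉ S := notMem_branch_root v u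
  have hρpos : 0 < ρ := specRad_bottleneck_pos hG.connected hW hs ⟨a, ha⟩ hvS
  have heq := hf.specRad_mul_laplacian_mulVec_eq hG.connected hW hvS h
  have hstep : ∀ c ∈ S, ∀ b ∈ S, G.Adj c b → blockAt f c = 0 → blockAt f b = 0 := by
    intro c hc b _ hcb hfc
    have hcut : SupportedOn S (cut (branch G c b) f) := fun p hp => by
      simp [cut, hf p hp]
    have h1 : ρ * (cut (branch G c b) f ⬝ᵥ laplacian G W *ᵥ cut (branch G c b) f) =
        cut (branch G c b) f ⬝ᵥ cut (branch G c b) f :=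
      mul_dotProduct_laplacian_cut_branch hfc fun p _ hfp =>
        heq p (by_contra fun hp => hfp (hf p hp))
    have h2 : W s(c, b) *ᵥ blockAt f b = 0 := by
      ext i
      have h3 := hcut.specRad_mul_laplacian_mulVec_eq hG.connected hW hvS h1.le (c, i) hc
      rw [laplacian_mulVec_cut_branch_root hG.isAcyclic hcb] at h3
      simp only [cut, notMem_branch_root, if_false, mul_neg, neg_eq_zero, mul_eq_zero] at h3
      exact h3.resolve_left hρpos.ne'
    by_contra hne
    have := (hW s(c, b) hcb).dotProduct_mulVec_pos hne
    rw [h2, dotProduct_zero] at this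
    exact lt_irrefl _ this
  have hall := forall_mem_branch_of_adj hstep ha hfa
  ext p
  by_cases hp : p.1 ∈ S
  · exact congrFun (hall p.1 hp) p.2
  · exact hf p hp

/-- A minimizer over a proper subset of a branch vanishes somewhere in the branch, so it cannot be a
minimizer over the branch. -/
theorem specRad_bottleneck_strictMono (hG : G.IsTree) (hW : ∀ e ∈ G.edgeSet, (W e).PosDef)
    (hs : 1 ≤ s) {S : Finset V} (hS : S.Nonempty) {v u : V} (hSS : S ⊂ branch G v u) :
    specRad (bottleneck G W S) < specRad (bottleneck G W (branch G v u)) := by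
  by_contra hlt
  rw [not_lt] at hlt
  have hvS : v ∉ S := fun h => notMem_branch_root v u (hSS.1 h)
  obtain ⟨f, h0, hf, h⟩ := exists_supportedOn_eigenvector hG.connected hW hs hS hvS
  obtain ⟨a, ha, haS⟩ := Finset.exists_of_ssubset hSS
  refine h0 (eq_zero_of_blockAt_eq_zero hG hW hs (hf.mono hSS.1) ?_ ha (hf.blockAt_eq_zero haS))
  rw [← h]
  refine mul_le_mul_of_nonneg_right hlt ?_
  simpa using (posSemidef_laplacian hW).dotProduct_mulVec_nonneg f

/-! ### Perron branches -/

theorem IsBranch.specRad_bottleneck_le (hG : G.Connected) (hW : ∀ e ∈ G.edgeSet, (W e).PosDef)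
    (hs : 1 ≤ s) {v : V} {B : Finset V} (h : IsBranch G v B) :
    specRad (bottleneck G W B) ≤ specRad (vertexInverse G W v) :=
  specRad_bottleneck_mono hG hW hs h.nonempty
    (fun x hx => by simpa using fun hxv : x = v => h.root_notMem (hxv ▸ hx))
    (by simp : v ∉ ({v}ᶜ : Finset V))

/-- A minimizer of the Rayleigh quotient on `V \ {v}` lives on Perron branches at `v`. -/
theorem isPerronBranch_of_blockAt_ne_zero (hG : G.Connected)
    (hW : ∀ e ∈ G.edgeSet, (W e).PosDef) (hs : 1 ≤ s) {v u : V} {f : V × Fin s → ℝ}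
    (hf : blockAt f v = 0)
    (h : specRad (vertexInverse G W v) * (f ⬝ᵥ laplacian G W *ᵥ f) ≤ f ⬝ᵥ f)
    (hu : blockAt f u ≠ 0) : IsPerronBranch G W v (branch G v u) := by
  have huv : u ≠ v := fun h => hu (h ▸ hf)
  have hB : IsBranch G v (branch G v u) := ⟨u, huv, rfl⟩
  have hsupp : SupportedOn ({v}ᶜ : Finset V) f := fun p hp => by
    obtain ⟨a, i⟩ := p
    obtain rfl : a = v := by simpa using hp
    exact congrFun hf i
  have hv : v ∉ ({v}ᶜ : Finset V) := by simp
  have heq := hsupp.specRad_mul_laplacian_mulVec_eq hG hW hv h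
  refine ⟨hB, le_antisymm (hB.specRad_bottleneck_le hG hW hs)
    ((supportedOn_cut _ f).le_specRad_bottleneck hG hW hB.root_notMem (fun h0 => hu ?_)
      (mul_dotProduct_laplacian_cut_branch hf fun p hp _ =>
        heq p (by simpa using ne_of_mem_branch hp)).le)⟩
  have h1 := blockAt_cut (branch G v u) f u
  rw [h0, if_pos (mem_branch_self huv)] at h1
  exact h1.symm

theorem exists_isPerronBranch [Nontrivial V] (hG : G.Connected)
    (hW : ∀ e ∈ G.edgeSet, (W e).PosDef) (hs : 1 ≤ s) (v : V) :
    ∃ u, G.Adj v u ∧ IsPerronBranch G W v (branch G v u) := by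
  have hv : v ∉ ({v}ᶜ : Finset V) := by simp
  obtain ⟨w, hw⟩ := exists_ne v
  obtain ⟨f, h0, hf, h⟩ := exists_supportedOn_eigenvector hG hW hs
    (S := {v}ᶜ) ⟨w, by simpa using hw⟩ hv
  obtain ⟨⟨u, i⟩, hp⟩ := Function.ne_iff.1 h0
  have hP := isPerronBranch_of_blockAt_ne_zero hG hW hs (hf.blockAt_eq_zero hv) h.le
    (u := u) (fun h => hp (congrFun h i))
  obtain ⟨b, hb, hbe⟩ := hP.1.exists_adj hG
  exact ⟨b, hb, hbe ▸ hP⟩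

/-- If some Perron branch at `v` misses `w`, then the only Perron branch at `w` is the one
towards `v`. -/
theorem IsPerronBranch.perronBranchToward [Nontrivial V] (hG : G.IsTree)
    (hW : ∀ e ∈ G.edgeSet, (W e).PosDef) (hs : 1 ≤ s) {v w : V} {B : Finset V}
    (hB : IsPerronBranch G W v B) (hwv : w ≠ v) (hw : w ∉ B) : PerronBranchToward G W w v := by
  have key : ∀ C, IsPerronBranch G W w C → C = branch G w v := by
    rintro C ⟨hC, hCρ⟩
    obtain ⟨x, hx, rfl⟩ := hC
    obtain ⟨y, hy, rfl⟩ := hB.1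
    by_cases hv : v ∈ branch G w x
    · exact (branch_eq_of_mem hv).symm
    · -- With `B` the given branch, `ρ(B) < ρ(B_w(v)) ≤ ρ(M_w) = ρ(C) < ρ(B_v(w)) ≤ ρ(M_v) = ρ(B)`.
      have h1 := specRad_bottleneck_strictMono hG hW hs (hB.1.nonempty)
        (branch_ssubset_branch hG.connected hwv hy hw)
      have h2 := specRad_bottleneck_strictMono hG hW hs ⟨x, mem_branch_self hx⟩
        (branch_ssubset_branch hG.connected hwv.symm hx hv)
      have h3 := IsBranch.specRad_bottleneck_le hG.connected hW hs ⟨w, hwv, rfl⟩ (v := v)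
      have h4 := IsBranch.specRad_bottleneck_le hG.connected hW hs ⟨v, hwv.symm, rfl⟩ (v := w)
      have h5 := hB.2
      exact absurd h5 (by linarith)
  intro C
  refine ⟨key C, ?_⟩
  rintro rfl
  obtain ⟨u, _, hu⟩ := exists_isPerronBranch hG.connected hW hs w
  exact key _ hu ▸ hu

theorem HasTwoPerronBranches.perronBranchToward [Nontrivial V] (hG : G.IsTree)
    (hW : ∀ e ∈ G.edgeSet, (W e).PosDef) (hs : 1 ≤ s) {v w : V}
    (hv : HasTwoPerronBranches G W v) (hwv : w ≠ v) : PerronBranchToward G W w v := by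
  obtain ⟨B₁, B₂, hne, h₁, h₂⟩ := hv
  by_cases hw : w ∈ B₁
  · refine h₂.perronBranchToward hG hW hs hwv fun hw2 => hne ?_
    obtain ⟨x, _, rfl⟩ := h₁.1
    obtain ⟨y, _, rfl⟩ := h₂.1
    rw [← branch_eq_of_mem hw, branch_eq_of_mem hw2]
  · exact h₁.perronBranchToward hG hW hs hwv hw

theorem PerronBranchToward.branch_eq {v u w : V} (h : PerronBranchToward G W v u)
    (h' : PerronBranchToward G W v w) : branch G v u = branch G v w :=
  (h' _).1 ((h _).2 rfl)

theorem PerronBranchToward.not_hasTwoPerronBranches {v u : V} (h : PerronBranchToward G W v u) :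
    ¬ HasTwoPerronBranches G W v := by
  rintro ⟨B₁, B₂, hne, h₁, h₂⟩
  exact hne (((h _).1 h₁).trans ((h _).1 h₂).symm)

theorem HasTwoPerronBranches.isCharacteristicLikeVertex [Nontrivial V] (hG : G.IsTree)
    (hW : ∀ e ∈ G.edgeSet, (W e).PosDef) (hs : 1 ≤ s) {v : V}
    (hv : HasTwoPerronBranches G W v) : IsCharacteristicLikeVertex G W v :=
  ⟨hv, fun _ hw => by_contra fun hwv =>
    (hv.perronBranchToward hG hW hs hwv).not_hasTwoPerronBranches hw⟩

/-- The two ends of an edge cannot both have their only Perron branch towards a third vertex and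
towards each other. -/
theorem PerronBranchesFacing.false_of_toward (hG : G.IsAcyclic) {x y z : V}
    (h : PerronBranchesFacing G W x y) (hx : PerronBranchToward G W x z)
    (hy : PerronBranchToward G W y z) (hzx : z ≠ x) (hzy : z ≠ y) : False := by
  refine notMem_branch_of_mem_branch_symm hG h.1 (x := z) ?_ ?_
  · rw [h.2.1.branch_eq hx]
    exact mem_branch_self hzx
  · rw [h.2.2.branch_eq hy]
    exact mem_branch_self hzy

theorem HasTwoPerronBranches.not_perronBranchesFacing [Nontrivial V] (hG : G.IsTree)
    (hW : ∀ e ∈ G.edgeSet, (W e).PosDef) (hs : 1 ≤ s) {v x y : V}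
    (hv : HasTwoPerronBranches G W v) : ¬ PerronBranchesFacing G W x y := by
  intro h
  have hx : x ≠ v := fun hx => h.2.1.not_hasTwoPerronBranches (hx ▸ hv)
  have hy : y ≠ v := fun hy => h.2.2.not_hasTwoPerronBranches (hy ▸ hv)
  exact h.false_of_toward hG.isAcyclic (hv.perronBranchToward hG hW hs hx)
    (hv.perronBranchToward hG hW hs hy) hx.symm hy.symm

theorem PerronBranchesFacing.symm {u v : V} (h : PerronBranchesFacing G W u v) :
    PerronBranchesFacing G W v u := ⟨h.1.symm, h.2.2, h.2.1⟩

/-- An edge `xy` other than `uv` lies on one side of `uv`, and then the Perron branches at `x` and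
`y` both point to `uv`. -/
theorem PerronBranchesFacing.eq_of_mem_branch [Nontrivial V] (hG : G.IsTree)
    (hW : ∀ e ∈ G.edgeSet, (W e).PosDef) (hs : 1 ≤ s) {u v x y : V}
    (h : PerronBranchesFacing G W u v) (h' : PerronBranchesFacing G W x y)
    (hx : x ∈ branch G v u) : s(x, y) = s(u, v) := by
  by_cases hyv : y = v
  · subst hyv
    rw [eq_of_adj_of_mem_branch hG.isAcyclic h.1.symm h'.1.symm hx]
  exfalso
  have hy := mem_branch_of_adj hx h'.1 hyv
  have hx' := notMem_branch_of_mem_branch_symm hG.isAcyclic h.1.symm hx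
  have hy' := notMem_branch_of_mem_branch_symm hG.isAcyclic h.1.symm hy
  have hP : IsPerronBranch G W u (branch G u v) := (h.2.1 _).2 rfl
  by_cases hxu : x = u
  · subst hxu
    exact hy' (h'.2.1.branch_eq h.2.1 ▸ mem_branch_self h'.1.ne')
  by_cases hyu : y = u
  · subst hyu
    exact hx' (h'.2.2.branch_eq h.2.1 ▸ mem_branch_self h'.1.ne)
  exact h'.false_of_toward hG.isAcyclic (hP.perronBranchToward hG hW hs hxu hx')
    (hP.perronBranchToward hG hW hs hyu hy') (Ne.symm hxu) (Ne.symm hyu)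

theorem PerronBranchesFacing.isCharacteristicLikeEdge [Nontrivial V] (hG : G.IsTree)
    (hW : ∀ e ∈ G.edgeSet, (W e).PosDef) (hs : 1 ≤ s) {u v : V}
    (h : PerronBranchesFacing G W u v) : IsCharacteristicLikeEdge G W u v := by
  refine ⟨h, fun x y h' => ?_⟩
  rcases mem_branch_or_mem_branch_symm hG.connected h.1 x with hx | hx
  · exact h.eq_of_mem_branch hG hW hs h' hx
  · rw [h.symm.eq_of_mem_branch hG hW hs h' hx, Sym2.eq_swap]

/-- If every vertex has a single Perron branch, following the edge into it maps vertices to edges.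
A tree has fewer edges than vertices, so two vertices share their edge, and their Perron branches
face each other. -/
theorem exists_hasTwoPerronBranches_or_perronBranchesFacing [Nontrivial V] (hG : G.IsTree)
    (hW : ∀ e ∈ G.edgeSet, (W e).PosDef) (hs : 1 ≤ s) :
    (∃ v, HasTwoPerronBranches G W v) ∨ ∃ u v, PerronBranchesFacing G W u v := by
  by_cases h2 : ∃ v, HasTwoPerronBranches G W v
  · exact .inl h2
  right
  push Not at h2
  choose n hn hP using fun v => exists_isPerronBranch hG.connected hW hs v
  have htow : ∀ v, PerronBranchToward G W v (n v) := fun v B =>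
    ⟨fun hB => by_contra fun hne => h2 v ⟨_, _, hne, hB, hP v⟩, fun hB => hB ▸ hP v⟩
  obtain ⟨v, _, w, _, hvw, he⟩ := Finset.exists_ne_map_eq_of_card_lt_of_maps_to
    (s := Finset.univ) (t := G.edgeFinset) (f := fun v => s(v, n v))
    (by have := hG.card_edgeFinset; rw [Finset.card_univ]; omega)
    (fun v _ => by simpa using hn v)
  rcases Sym2.eq_iff.1 he with h | h
  · exact absurd h.1 hvw
  · refine ⟨v, w, h.2 ▸ hn v, h.2 ▸ htow v, ?_⟩
    rw [h.1]
    exact htow w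

end Perron

/-! ### Shortening the root edge of a branch -/

section Shifted

open Matrix

variable {V : Type*} {s : ℕ}

/-- The block column `1 ⊗ I` over `S`, which spreads a vector of `ℝˢ` constantly over `S`. -/
def onesBlock (S : Finset V) (s : ℕ) : Matrix (S × Fin s) (Fin s) ℝ :=
  Matrix.of fun p j => if p.2 = j then 1 else 0

theorem onesBlock_mulVec (S : Finset V) (c : Fin s → ℝ) :
    onesBlock S s *ᵥ c = restrictTo S (constVec c) := by
  ext p
  simp [onesBlock, mulVec, dotProduct, restrictTo, constVec]

theorem ones_kronecker_eq (S : Finset V) (X : Matrix (Fin s) (Fin s) ℝ) :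
    (Matrix.of fun _ _ => (1 : ℝ) : Matrix S S ℝ) ⊗ₖ X =
      onesBlock S s * X * (onesBlock S s)ᵀ := by
  ext ⟨a, i⟩ ⟨b, j⟩
  simp [onesBlock, Matrix.mul_apply, kroneckerMap_apply]

theorem posSemidef_onesBlock_mul {S : Finset V} {X : Matrix (Fin s) (Fin s) ℝ} (hX : X.PosDef) :
    (onesBlock S s * X⁻¹ * (onesBlock S s)ᵀ).PosSemidef := by
  simpa using hX.inv.posSemidef.mul_mul_conjTranspose_same (onesBlock S s)

variable [DecidableEq V]

/-- The block column `eᵥ ⊗ I` over `S`, which places a vector of `ℝˢ` at the vertex `v`. -/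
def singleBlock (S : Finset V) (s : ℕ) (v : V) : Matrix (S × Fin s) (Fin s) ℝ :=
  Matrix.of fun p j => if p.1.1 = v ∧ p.2 = j then 1 else 0

theorem singleBlock_mulVec (S : Finset V) (v : V) (c : Fin s → ℝ) (p : S × Fin s) :
    (singleBlock S s v *ᵥ c) p = if p.1.1 = v then c p.2 else 0 := by
  by_cases h : p.1.1 = v <;> simp [singleBlock, mulVec, dotProduct, h]

theorem singleBlock_transpose_mulVec {S : Finset V} {v : V} (hv : v ∈ S) (x : S × Fin s → ℝ) :
    (singleBlock S s v)ᵀ *ᵥ x = fun i => x (⟨v, hv⟩, i) := by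
  ext i
  rw [mulVec, dotProduct, Finset.sum_eq_single (⟨v, hv⟩, i)]
  · simp [singleBlock]
  · rintro ⟨a, j⟩ _ hne
    have : ¬ (a.1 = v ∧ j = i) := fun h => hne (Prod.ext (Subtype.ext h.1) h.2)
    simp [singleBlock, this]
  · simp

theorem singleBlock_transpose_mul_onesBlock {S : Finset V} {v : V} (hv : v ∈ S) :
    (singleBlock S s v)ᵀ * onesBlock S s = 1 := by
  ext i j
  have := congrFun (singleBlock_transpose_mulVec hv fun p => onesBlock S s p j) i
  rw [Matrix.mul_apply, Matrix.one_apply]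
  exact this

section Algebra

variable {S : Finset V} {v : V} {A : Matrix (S × Fin s) (S × Fin s) ℝ}
  {X : Matrix (Fin s) (Fin s) ℝ}

/-- The block row of `A⁻¹` at `v` is constantly `X⁻¹`. -/
theorem onesBlock_transpose_eq (hA : A.PosDef) (hX : X.PosDef)
    (h : A * onesBlock S s = singleBlock S s v * X) :
    X * (singleBlock S s v)ᵀ * A⁻¹ = (onesBlock S s)ᵀ := by
  have hu := (Matrix.isUnit_iff_isUnit_det _).1 hA.isUnit
  have h1 := congrArg Matrix.transpose h
  have hA' : Aᵀ = A := by simpa using hA.1.eq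
  have hX' : Xᵀ = X := by simpa using hX.1.eq
  rw [transpose_mul, transpose_mul, hA', hX'] at h1
  rw [← h1, Matrix.mul_assoc, Matrix.mul_nonsing_inv _ hu, Matrix.mul_one]

/-- Replacing the resistance `X⁻¹` of the root edge by `(1 - t) X⁻¹` turns its conductance `X` into
`(1 - t)⁻¹ X = X + (t / (1 - t)) X`. -/
theorem inv_add_smul_eq (hv : v ∈ S) (hA : A.PosDef) (hX : X.PosDef)
    (h : A * onesBlock S s = singleBlock S s v * X) {t : ℝ} (ht : t < 1) :
    (A + (t / (1 - t)) • (singleBlock S s v * X * (singleBlock S s v)ᵀ))⁻¹ =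
      A⁻¹ - t • (onesBlock S s * X⁻¹ * (onesBlock S s)ᵀ) := by
  have hu := (Matrix.isUnit_iff_isUnit_det _).1 hA.isUnit
  have huX := (Matrix.isUnit_iff_isUnit_det _).1 hX.isUnit
  refine Matrix.inv_eq_right_inv ?_
  have h1 : A * (onesBlock S s * X⁻¹ * (onesBlock S s)ᵀ) =
      singleBlock S s v * (onesBlock S s)ᵀ := by
    rw [← Matrix.mul_assoc, ← Matrix.mul_assoc, h, Matrix.mul_assoc (singleBlock S s v),
      Matrix.mul_nonsing_inv _ huX, Matrix.mul_one]
  have h2 : singleBlock S s v * X * (singleBlock S s v)ᵀ * A⁻¹ =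
      singleBlock S s v * (onesBlock S s)ᵀ := by
    rw [← onesBlock_transpose_eq hA hX h]
    simp only [Matrix.mul_assoc]
  have h3 : singleBlock S s v * X * (singleBlock S s v)ᵀ *
      (onesBlock S s * X⁻¹ * (onesBlock S s)ᵀ) = singleBlock S s v * (onesBlock S s)ᵀ := by
    calc _ = singleBlock S s v * (X * ((singleBlock S s v)ᵀ * onesBlock S s) * X⁻¹) *
          (onesBlock S s)ᵀ := by simp only [Matrix.mul_assoc]
      _ = _ := by
        rw [singleBlock_transpose_mul_onesBlock hv, Matrix.mul_one, Matrix.mul_nonsing_inv _ huX,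
          Matrix.mul_one]
  rw [Matrix.add_mul, Matrix.mul_sub, Matrix.mul_sub, Matrix.mul_nonsing_inv _ hu, mul_smul_comm,
    h1, smul_mul_assoc, h2, mul_smul_comm, smul_mul_assoc, h3, smul_smul, sub_add, ← sub_smul,
    ← sub_smul]
  have hc : t - (t / (1 - t) - t * (t / (1 - t))) = 0 := by
    have : (1 - t) ≠ 0 := by linarith
    field_simp
    ring
  rw [hc, zero_smul, sub_zero]

/-- With the root edge contracted, nothing is left at the root. -/
theorem singleBlock_transpose_mul_sub (hv : v ∈ S) (hA : A.PosDef) (hX : X.PosDef)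
    (h : A * onesBlock S s = singleBlock S s v * X) :
    (singleBlock S s v)ᵀ * (A⁻¹ - onesBlock S s * X⁻¹ * (onesBlock S s)ᵀ) = 0 := by
  have huX := (Matrix.isUnit_iff_isUnit_det _).1 hX.isUnit
  rw [Matrix.mul_sub, ← Matrix.mul_assoc, ← Matrix.mul_assoc,
    singleBlock_transpose_mul_onesBlock hv, Matrix.one_mul, ← onesBlock_transpose_eq hA hX h,
    ← Matrix.mul_assoc, ← Matrix.mul_assoc, Matrix.nonsing_inv_mul _ huX, Matrix.one_mul, sub_self]

/-- With `1 = 1 ⊗ I`, the matrix `P = A⁻¹ - 1 X⁻¹ 1ᵀ` satisfies `P A P = P`, so it is positive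
semidefinite along with `A`. -/
theorem sub_mul_mul_sub (hv : v ∈ S) (hA : A.PosDef) (hX : X.PosDef)
    (h : A * onesBlock S s = singleBlock S s v * X) :
    (A⁻¹ - onesBlock S s * X⁻¹ * (onesBlock S s)ᵀ) * A *
      (A⁻¹ - onesBlock S s * X⁻¹ * (onesBlock S s)ᵀ) =
      A⁻¹ - onesBlock S s * X⁻¹ * (onesBlock S s)ᵀ := by
  have hu := (Matrix.isUnit_iff_isUnit_det _).1 hA.isUnit
  have h0 := singleBlock_transpose_mul_sub hv hA hX h
  have h1 := onesBlock_transpose_eq hA hX h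
  have h2 : (onesBlock S s)ᵀ * A = X * (singleBlock S s v)ᵀ := by
    rw [← h1, Matrix.mul_assoc, Matrix.nonsing_inv_mul _ hu, Matrix.mul_one]
  have h3 : (A⁻¹ - onesBlock S s * X⁻¹ * (onesBlock S s)ᵀ) * A =
      1 - onesBlock S s * X⁻¹ * (X * (singleBlock S s v)ᵀ) := by
    rw [Matrix.sub_mul, Matrix.nonsing_inv_mul _ hu, Matrix.mul_assoc (_ * _), h2]
  rw [h3, Matrix.sub_mul, Matrix.one_mul, Matrix.mul_assoc _ (X * _), Matrix.mul_assoc X, h0,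
    Matrix.mul_zero, Matrix.mul_zero, sub_zero]

theorem posSemidef_sub_smul (hv : v ∈ S) (hA : A.PosDef) (hX : X.PosDef)
    (h : A * onesBlock S s = singleBlock S s v * X) {t : ℝ} (ht : t ≤ 1) :
    (A⁻¹ - t • (onesBlock S s * X⁻¹ * (onesBlock S s)ᵀ)).PosSemidef := by
  have h1 : (A⁻¹ - onesBlock S s * X⁻¹ * (onesBlock S s)ᵀ).PosSemidef := by
    rw [← sub_mul_mul_sub hv hA hX h]
    have hH : (A⁻¹ - onesBlock S s * X⁻¹ * (onesBlock S s)ᵀ)ᴴ =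
        A⁻¹ - onesBlock S s * X⁻¹ * (onesBlock S s)ᵀ :=
      (hA.inv.1.sub (posSemidef_onesBlock_mul hX).1).eq
    have h2 := hA.posSemidef.conjTranspose_mul_mul_same
      (A⁻¹ - onesBlock S s * X⁻¹ * (onesBlock S s)ᵀ)
    rwa [hH] at h2
  have h2 := h1.add ((posSemidef_onesBlock_mul (S := S) hX).smul (sub_nonneg.2 ht))
  rwa [sub_smul, one_smul, sub_add_sub_cancel] at h2

end Algebra

variable [Fintype V] {G : SimpleGraph V}

theorem cut_branch_eq_sub (hG : G.IsTree) {u v : V} (huv : G.Adj u v) (f : V × Fin s → ℝ) :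
    cut (branch G u v) f = f - cut (branch G v u) f := by
  ext p
  rcases mem_branch_or_mem_branch_symm hG.connected huv p.1 with h | h
  · simp [cut, h, notMem_branch_of_mem_branch_symm hG.isAcyclic huv.symm h]
  · simp [cut, h, notMem_branch_of_mem_branch_symm hG.isAcyclic huv h]

theorem dotProduct_self_eq_add_cut (hG : G.IsTree) {u v : V} (huv : G.Adj u v)
    (y : V × Fin s → ℝ) : y ⬝ᵥ y = cut (branch G v u) y ⬝ᵥ cut (branch G v u) y +
      cut (branch G u v) y ⬝ᵥ cut (branch G u v) y := by
  simp only [dotProduct, ← Finset.sum_add_distrib]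
  refine Finset.sum_congr rfl fun p _ => ?_
  rcases mem_branch_or_mem_branch_symm hG.connected huv p.1 with h | h
  · simp [cut, h, notMem_branch_of_mem_branch_symm hG.isAcyclic huv.symm h]
  · simp [cut, h, notMem_branch_of_mem_branch_symm hG.isAcyclic huv h]

variable [DecidableRel G.Adj] {W : Sym2 V → Matrix (Fin s) (Fin s) ℝ}

/-- `L_B (1 ⊗ I) = eᵥ ⊗ W(uv)` for the branch `B` at `u` containing its neighbour `v`. -/
theorem principalBlock_mul_onesBlock (hG : G.IsTree) {u v : V} (huv : G.Adj u v) :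
    principalBlock G W (branch G u v) * onesBlock (branch G u v) s =
      singleBlock (branch G u v) s v * W s(u, v) := by
  refine Matrix.mulVec_injective (funext fun c => ?_)
  rw [← mulVec_mulVec, ← mulVec_mulVec, onesBlock_mulVec]
  have h1 : restrictTo (branch G u v) (constVec c) =
      restrictTo (branch G u v) (cut (branch G u v) (constVec c)) := by
    ext p; simp [restrictTo, cut]
  rw [h1, (supportedOn_cut _ _).principalBlock_mulVec, cut_branch_eq_sub hG huv, mulVec_sub,
    laplacian_mulVec_constVec, zero_sub]
  ext ⟨⟨a, ha⟩, i⟩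
  rw [singleBlock_mulVec]
  simp only [restrictTo, Pi.neg_apply]
  split_ifs with hav
  · subst hav
    rw [laplacian_mulVec_cut_branch_root hG.isAcyclic huv.symm, neg_neg, Sym2.eq_swap]
    rfl
  · rw [laplacian_mulVec_cut_branch_of_notMem _
      (notMem_branch_of_mem_branch_symm hG.isAcyclic huv ha) hav, neg_zero]

theorem shiftedBottleneck_eq (u v : V) (t : ℝ) : shiftedBottleneck G W u v t =
    (principalBlock G W (branch G u v))⁻¹ - t • (onesBlock (branch G u v) s * (W s(u, v))⁻¹ *
      (onesBlock (branch G u v) s)ᵀ) := by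
  rw [shiftedBottleneck, ones_kronecker_eq, bottleneck]

theorem shiftedBottleneck_zero (u v : V) :
    shiftedBottleneck G W u v 0 = bottleneck G W (branch G u v) := by
  rw [shiftedBottleneck, zero_smul, sub_zero]

theorem posSemidef_shiftedBottleneck (hG : G.IsTree) (hW : ∀ e ∈ G.edgeSet, (W e).PosDef)
    {u v : V} (huv : G.Adj u v) {t : ℝ} (ht : t ≤ 1) :
    (shiftedBottleneck G W u v t).PosSemidef := by
  rw [shiftedBottleneck_eq]
  exact posSemidef_sub_smul (mem_branch_self huv.ne')
    (posDef_principalBlock hG.connected hW (notMem_branch_root u v)) (hW s(u, v) huv)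
    (principalBlock_mul_onesBlock hG huv) ht

theorem continuousOn_specRad_shiftedBottleneck (hG : G.IsTree)
    (hW : ∀ e ∈ G.edgeSet, (W e).PosDef) {u v : V} (huv : G.Adj u v) :
    ContinuousOn (fun t => specRad (shiftedBottleneck G W u v t)) (Set.Iic 1) := by
  have h := fun t (ht : t ∈ Set.Iic (1 : ℝ)) => posSemidef_shiftedBottleneck hG hW huv ht
  simp only [shiftedBottleneck_eq] at h ⊢
  exact continuousOn_specRad_sub_smul (posSemidef_onesBlock_mul (hW s(u, v) huv)) h

theorem antitoneOn_specRad_shiftedBottleneck (hG : G.IsTree)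
    (hW : ∀ e ∈ G.edgeSet, (W e).PosDef) {u v : V} (huv : G.Adj u v) :
    AntitoneOn (fun t => specRad (shiftedBottleneck G W u v t)) (Set.Iic 1) := by
  have h := fun t (ht : t ∈ Set.Iic (1 : ℝ)) => posSemidef_shiftedBottleneck hG hW huv ht
  simp only [shiftedBottleneck_eq] at h ⊢
  exact antitoneOn_specRad_sub_smul (posSemidef_onesBlock_mul (hW s(u, v) huv)) h

/-- Contracting the edge `uv` leaves only branches at `v` that avoid `u`, and none of these is a
Perron branch at `v`. -/
theorem specRad_shiftedBottleneck_one_lt [Nontrivial V] (hG : G.IsTree)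
    (hW : ∀ e ∈ G.edgeSet, (W e).PosDef) (hs : 1 ≤ s) {u v : V} (huv : G.Adj u v)
    (hP : PerronBranchToward G W v u) :
    specRad (shiftedBottleneck G W u v 1) < specRad (vertexInverse G W v) := by
  by_contra hlt
  rw [not_lt] at hlt
  have hvB := mem_branch_self (G := G) huv.ne'
  have hA := posDef_principalBlock hG.connected hW (notMem_branch_root (G := G) u v)
  have hAo := principalBlock_mul_onesBlock (W := W) hG huv
  have := nonempty_prod_fin hs ⟨v, hvB⟩
  have hMpos : 0 < specRad (vertexInverse G W v) :=
    specRad_bottleneck_pos hG.connected hW hs (S := {v}ᶜ) ⟨u, by simpa using huv.ne⟩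
      (v := v) (by simp)
  have hpsd := posSemidef_shiftedBottleneck hG hW huv (le_refl (1 : ℝ))
  obtain ⟨x, hx0, hx⟩ := exists_mulVec_eq_specRad_smul hpsd
  set ρ := specRad (shiftedBottleneck G W u v 1) with hρ
  have hρpos : 0 < ρ := hMpos.trans_le hlt
  have hsh := shiftedBottleneck_eq (G := G) (W := W) u v 1
  rw [one_smul] at hsh
  -- The top eigenvector vanishes at `v`, so it is a test vector on the branches at `v`.
  have hxv : ∀ i, x (⟨v, hvB⟩, i) = 0 := by
    have h1 := congrArg (fun y => (singleBlock (branch G u v) s v)ᵀ *ᵥ y) hx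
    beta_reduce at h1
    rw [mulVec_mulVec, hsh, singleBlock_transpose_mul_sub hvB hA (hW s(u, v) huv) hAo, zero_mulVec,
      mulVec_smul, singleBlock_transpose_mulVec hvB] at h1
    intro i
    have h2 := congrFun h1 i
    simp only [Pi.zero_apply, Pi.smul_apply, smul_eq_mul] at h2
    exact (mul_eq_zero.1 h2.symm).resolve_left hρpos.ne'
  have hquad : ρ * (x ⬝ᵥ principalBlock G W (branch G u v) *ᵥ x) = x ⬝ᵥ x := by
    have h1 := sub_mul_mul_sub hvB hA (hW s(u, v) huv) hAo
    rw [← hsh] at h1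
    have h2 : x ⬝ᵥ (shiftedBottleneck G W u v 1 * principalBlock G W (branch G u v) *
        shiftedBottleneck G W u v 1) *ᵥ x = ρ * (x ⬝ᵥ x) := by
      rw [h1, hx, dotProduct_smul, smul_eq_mul]
    have hsym : (shiftedBottleneck G W u v 1)ᵀ = shiftedBottleneck G W u v 1 := by
      simpa using hpsd.1.eq
    rw [← mulVec_mulVec, ← mulVec_mulVec, hx, dotProduct_mulVec, ← mulVec_transpose, hsym, hx,
      mulVec_smul, dotProduct_smul, smul_dotProduct, smul_eq_mul, smul_eq_mul] at h2
    exact mul_left_cancel₀ hρpos.ne' h2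
  have hf := supportedOn_extendZero (branch G u v) x
  rw [← restrictTo_extendZero (branch G u v) x, hf.principalBlock_mulVec,
    hf.restrictTo_dotProduct, hf.restrictTo_dotProduct] at hquad
  set f := extendZero (branch G u v) x with hfdef
  have hfv : blockAt f v = 0 := by
    ext i
    simp [blockAt, hfdef, extendZero, hvB, hxv i]
  have hle : specRad (vertexInverse G W v) * (f ⬝ᵥ laplacian G W *ᵥ f) ≤ f ⬝ᵥ f := by
    rw [← hquad]
    refine mul_le_mul_of_nonneg_right hlt ?_
    simpa using (posSemidef_laplacian hW).dotProduct_mulVec_nonneg f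
  obtain ⟨⟨⟨w, hw⟩, i⟩, hp⟩ := Function.ne_iff.1 hx0
  have hfw : blockAt f w ≠ 0 := fun h => hp (by
    have := congrFun h i
    simpa [blockAt, hfdef, extendZero, hw] using this)
  have hwv : w ≠ v := fun h => hfw (h ▸ hfv)
  have h1 := (hP _).1 (isPerronBranch_of_blockAt_ne_zero hG.connected hW hs hfv hle hfw)
  exact notMem_branch_of_mem_branch_symm hG.isAcyclic huv hw (h1 ▸ mem_branch_self hwv)

/-- The Rayleigh bound for a branch whose root edge has been shortened by the factor `1 - t`. -/
theorem SupportedOn.dotProduct_self_le_shifted (hG : G.IsTree)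
    (hW : ∀ e ∈ G.edgeSet, (W e).PosDef) {u v : V} (huv : G.Adj u v) {t : ℝ} (ht0 : 0 ≤ t)
    (ht : t < 1) {f : V × Fin s → ℝ} (hf : SupportedOn (branch G u v) f) :
    f ⬝ᵥ f ≤ specRad (shiftedBottleneck G W u v t) * (f ⬝ᵥ laplacian G W *ᵥ f +
      t / (1 - t) * (blockAt f v ⬝ᵥ W s(u, v) *ᵥ blockAt f v)) := by
  have hvB := mem_branch_self (G := G) huv.ne'
  have hA := posDef_principalBlock hG.connected hW (notMem_branch_root (G := G) u v)
  have hX := hW s(u, v) huv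
  have hinv := inv_add_smul_eq hvB hA hX (principalBlock_mul_onesBlock hG huv) ht
  rw [← shiftedBottleneck_eq] at hinv
  have hE : (singleBlock (branch G u v) s v * W s(u, v) *
      (singleBlock (branch G u v) s v)ᵀ).PosSemidef := by
    simpa using hX.posSemidef.mul_mul_conjTranspose_same (singleBlock (branch G u v) s v)
  have h := dotProduct_self_le_specRad_inv_mul
    (hA.add_posSemidef (hE.smul (div_nonneg ht0 (sub_pos.2 ht).le))) (restrictTo _ f)
  rw [hinv, add_mulVec, dotProduct_add, hf.principalBlock_mulVec, hf.restrictTo_dotProduct,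
    hf.restrictTo_dotProduct, smul_mulVec, dotProduct_smul, smul_eq_mul, ← mulVec_mulVec,
    ← mulVec_mulVec, dotProduct_mulVec _ (singleBlock _ s v), ← mulVec_transpose,
    singleBlock_transpose_mulVec hvB] at h
  exact h

end Shifted

/-! ### Existence and uniqueness of `κ` -/

section Kappa

open Matrix

variable {V : Type*} [Fintype V] [DecidableEq V] {s : ℕ} {G : SimpleGraph V} [DecidableRel G.Adj]
  {W : Sym2 V → Matrix (Fin s) (Fin s) ℝ}

theorem PerronBranchToward.specRad_bottleneck_eq {v u : V} (h : PerronBranchToward G W v u) :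
    specRad (bottleneck G W (branch G v u)) = specRad (vertexInverse G W v) :=
  ((h _).2 rfl).2

/-- As the point on a characteristic-like edge moves from one end to the other, the spectral radii
on the two sides cross. -/
theorem PerronBranchesFacing.exists_balance [Nontrivial V] (hG : G.IsTree)
    (hW : ∀ e ∈ G.edgeSet, (W e).PosDef) (hs : 1 ≤ s) {u v : V}
    (h : PerronBranchesFacing G W u v) :
    ∃ ν : ℝ, 0 < ν ∧ ν < 1 ∧
      specRad (shiftedBottleneck G W u v ν) = specRad (shiftedBottleneck G W v u (1 - ν)) := by
  have hc : ContinuousOn (fun t => specRad (shiftedBottleneck G W u v t) -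
      specRad (shiftedBottleneck G W v u (1 - t))) (Set.Icc 0 1) := by
    refine ((continuousOn_specRad_shiftedBottleneck hG hW h.1).mono fun t ht => ht.2).sub
      ((continuousOn_specRad_shiftedBottleneck hG hW h.1.symm).comp
        (by fun_prop) fun t ht => ?_)
    simpa using ht.1
  have h0 : 0 < specRad (shiftedBottleneck G W u v 0) -
      specRad (shiftedBottleneck G W v u (1 - 0)) := by
    rw [shiftedBottleneck_zero, h.2.1.specRad_bottleneck_eq, sub_zero, sub_pos]
    exact specRad_shiftedBottleneck_one_lt hG hW hs h.1.symm h.2.1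
  have h1 : specRad (shiftedBottleneck G W u v 1) -
      specRad (shiftedBottleneck G W v u (1 - 1)) < 0 := by
    rw [sub_self, shiftedBottleneck_zero, h.2.2.specRad_bottleneck_eq, sub_neg]
    exact specRad_shiftedBottleneck_one_lt hG hW hs h.1 h.2.2
  obtain ⟨ν, hν, hν0⟩ := intermediate_value_Ioo' zero_le_one hc ⟨h1, h0⟩
  exact ⟨ν, hν.1, hν.2, sub_eq_zero.1 hν0⟩

/-- The radius on one side is antitone and that on the other side monotone in the position on the
edge, so the radii can agree at several positions only with the same value. -/
theorem specRad_shiftedBottleneck_unique_of_le (hG : G.IsTree)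
    (hW : ∀ e ∈ G.edgeSet, (W e).PosDef) {u v : V} (huv : G.Adj u v) {t r : ℝ} (ht : 0 ≤ t)
    (hr : r ≤ 1) (htr : t ≤ r)
    (het : specRad (shiftedBottleneck G W u v t) = specRad (shiftedBottleneck G W v u (1 - t)))
    (her : specRad (shiftedBottleneck G W u v r) = specRad (shiftedBottleneck G W v u (1 - r))) :
    specRad (shiftedBottleneck G W u v t) = specRad (shiftedBottleneck G W u v r) := by
  refine le_antisymm ?_ (antitoneOn_specRad_shiftedBottleneck hG hW huv
    (htr.trans hr) hr htr)
  rw [het, her]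
  exact antitoneOn_specRad_shiftedBottleneck hG hW huv.symm (by simp; linarith)
    (by simpa using ht) (by linarith)

theorem specRad_shiftedBottleneck_unique (hG : G.IsTree)
    (hW : ∀ e ∈ G.edgeSet, (W e).PosDef) {u v : V} (huv : G.Adj u v) {t r : ℝ} (ht0 : 0 ≤ t)
    (ht1 : t ≤ 1) (hr0 : 0 ≤ r) (hr1 : r ≤ 1)
    (het : specRad (shiftedBottleneck G W u v t) = specRad (shiftedBottleneck G W v u (1 - t)))
    (her : specRad (shiftedBottleneck G W u v r) = specRad (shiftedBottleneck G W v u (1 - r))) :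
    specRad (shiftedBottleneck G W u v t) = specRad (shiftedBottleneck G W u v r) := by
  rcases le_total t r with h | h
  · exact specRad_shiftedBottleneck_unique_of_le hG hW huv ht0 hr1 h het her
  · exact (specRad_shiftedBottleneck_unique_of_le hG hW huv hr0 ht1 h her het).symm

theorem exists_isKappa [Nontrivial V] (hG : G.IsTree) (hW : ∀ e ∈ G.edgeSet, (W e).PosDef)
    (hs : 1 ≤ s) : ∃ κ, IsKappa G W κ := by
  rcases exists_hasTwoPerronBranches_or_perronBranchesFacing hG hW hs with ⟨v, hv⟩ | ⟨u, v, huv⟩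
  · exact ⟨_, .inl ⟨v, hv.isCharacteristicLikeVertex hG hW hs, rfl⟩⟩
  · obtain ⟨ν, h0, h1, h⟩ := huv.exists_balance hG hW hs
    exact ⟨_, .inr ⟨u, v, huv.isCharacteristicLikeEdge hG hW hs, ν, h0, h1, h, rfl⟩⟩

theorem IsKappa.unique [Nontrivial V] (hG : G.IsTree) (hW : ∀ e ∈ G.edgeSet, (W e).PosDef)
    (hs : 1 ≤ s) {k k' : ℝ} (hk : IsKappa G W k) (hk' : IsKappa G W k') : k = k' := by
  rcases hk with ⟨v, hv, rfl⟩ | ⟨u, v, huv, ν, h0, h1, h, rfl⟩ <;>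
    rcases hk' with ⟨v', hv', rfl⟩ | ⟨u', v', huv', ν', h0', h1', h', rfl⟩
  · rw [hv.2 v' hv'.1]
  · exact absurd huv'.1 (hv.1.not_perronBranchesFacing hG hW hs)
  · exact absurd huv.1 (hv'.1.not_perronBranchesFacing hG hW hs)
  · rcases Sym2.eq_iff.1 (huv.2 _ _ huv'.1) with ⟨rfl, rfl⟩ | ⟨rfl, rfl⟩
    · rw [specRad_shiftedBottleneck_unique hG hW huv.1.1 h0.le h1.le h0'.le h1'.le h h']
    · -- The same edge read backwards, so that `ν'` corresponds to `1 - ν'`.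
      rw [h', specRad_shiftedBottleneck_unique hG hW huv.1.1 h0.le h1.le (sub_pos.2 h1').le
        (by linarith) h (by rw [sub_sub_cancel, h'])]

/-! ### Comparison with the nonzero eigenvalues of the Laplacian -/

theorem dotProduct_constVec_eq_zero (hW : ∀ e ∈ G.edgeSet, (W e).PosDef) {f : V × Fin s → ℝ}
    {k : ℝ} (hk : k ≠ 0) (hf : laplacian G W *ᵥ f = k • f) (c : Fin s → ℝ) :
    f ⬝ᵥ constVec c = 0 := by
  have h := dotProduct_laplacian_mulVec_comm hW (constVec c) f
  rw [hf, laplacian_mulVec_constVec, dotProduct_zero, dotProduct_smul, smul_eq_mul,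
    dotProduct_comm] at h
  exact (mul_eq_zero.1 h).resolve_left hk

/-- An eigenvector for a nonzero eigenvalue is orthogonal to the constant vectors, so translating
it increases its norm while its energy stays the same. -/
theorem one_div_le_of_translate (hW : ∀ e ∈ G.edgeSet, (W e).PosDef) {f : V × Fin s → ℝ} {k : ℝ}
    (hk : k ≠ 0) (hf0 : f ≠ 0) (hf : laplacian G W *ᵥ f = k • f) {ρ : ℝ} (hρ : 0 ≤ ρ)
    {c : Fin s → ℝ} (h : (f - constVec c) ⬝ᵥ (f - constVec c) ≤
      ρ * ((f - constVec c) ⬝ᵥ laplacian G W *ᵥ (f - constVec c))) : 1 / ρ ≤ k := by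
  have horth := dotProduct_constVec_eq_zero hW hk hf c
  have hcc : 0 ≤ constVec c ⬝ᵥ (constVec c : V × Fin s → ℝ) := by
    simpa using dotProduct_star_self_nonneg (constVec c : V × Fin s → ℝ)
  have horth' : constVec c ⬝ᵥ f = 0 := by rw [dotProduct_comm, horth]
  rw [laplacian_mulVec_sub_constVec, hf, dotProduct_smul, smul_eq_mul] at h
  simp only [sub_dotProduct, dotProduct_sub, horth, horth'] at h
  have hff := dotProduct_self_pos hf0
  have h1 : 1 * (f ⬝ᵥ f) ≤ (ρ * k) * (f ⬝ᵥ f) := by linarith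
  have h2 := le_of_mul_le_mul_right h1 hff
  have hρ0 : 0 < ρ := lt_of_le_of_ne hρ fun h => by rw [← h] at h2; linarith
  rw [div_le_iff₀ hρ0]
  linarith

/-- The two sides of the edge `uv` interact through that edge only. -/
theorem cut_dotProduct_laplacian_cut (hG : G.IsTree) {u v : V} (huv : G.Adj u v)
    (y : V × Fin s → ℝ) :
    cut (branch G v u) y ⬝ᵥ laplacian G W *ᵥ cut (branch G u v) y =
      -(blockAt y u ⬝ᵥ W s(u, v) *ᵥ blockAt y v) := by
  rw [dotProduct_eq_sum_blockAt, Finset.sum_eq_single u]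
  · have h : blockAt (laplacian G W *ᵥ cut (branch G u v) y) u = -(W s(u, v) *ᵥ blockAt y v) :=
      funext fun i => laplacian_mulVec_cut_branch_root hG.isAcyclic huv y i
    rw [h, dotProduct_neg, blockAt_cut, if_pos (mem_branch_self huv.ne)]
  · intro a _ hau
    by_cases ha : a ∈ branch G v u
    · have h : blockAt (laplacian G W *ᵥ cut (branch G u v) y) a = 0 :=
        funext fun i => laplacian_mulVec_cut_branch_of_notMem y
          (notMem_branch_of_mem_branch_symm hG.isAcyclic huv.symm ha) hau i
      rw [h, dotProduct_zero]
    · rw [blockAt_cut, if_neg ha, zero_dotProduct]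
  · simp

/-- The energy of `y` is the sum of the energies on the two sides of the edge `uv`, provided that
`y` interpolates linearly along the edge and vanishes at the point dividing it as `ν : 1 - ν`. -/
theorem dotProduct_laplacian_eq_add_cut (hG : G.IsTree) (hW : ∀ e ∈ G.edgeSet, (W e).PosDef)
    {u v : V} (huv : G.Adj u v) {ν : ℝ} (h0 : 0 < ν) (h1 : ν < 1) {y : V × Fin s → ℝ}
    {d : Fin s → ℝ} (hu : blockAt y u = ν • d) (hv : blockAt y v = -((1 - ν) • d)) :
    y ⬝ᵥ laplacian G W *ᵥ y =
      (cut (branch G v u) y ⬝ᵥ laplacian G W *ᵥ cut (branch G v u) y +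
        (1 - ν) / ν * (blockAt y u ⬝ᵥ W s(u, v) *ᵥ blockAt y u)) +
      (cut (branch G u v) y ⬝ᵥ laplacian G W *ᵥ cut (branch G u v) y +
        ν / (1 - ν) * (blockAt y v ⬝ᵥ W s(u, v) *ᵥ blockAt y v)) := by
  have hy : y = cut (branch G v u) y + cut (branch G u v) y := by
    rw [cut_branch_eq_sub hG huv]; abel
  have hx := cut_dotProduct_laplacian_cut (W := W) hG huv y
  have hx' := dotProduct_laplacian_mulVec_comm hW (cut (branch G u v) y) (cut (branch G v u) y)
  have h0' : ν ≠ 0 := h0.ne'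
  have h1' : 1 - ν ≠ 0 := (sub_pos.2 h1).ne'
  nth_rw 1 2 [hy]
  rw [mulVec_add, add_dotProduct, dotProduct_add, dotProduct_add, hx', hx, hu, hv]
  simp only [mulVec_neg, mulVec_smul, dotProduct_neg, neg_dotProduct, dotProduct_smul,
    smul_dotProduct, smul_eq_mul]
  field_simp
  ring

theorem IsKappa.le_of_eigenvector (hG : G.IsTree)
    (hW : ∀ e ∈ G.edgeSet, (W e).PosDef) {κ : ℝ} (hκ : IsKappa G W κ)
    {f : V × Fin s → ℝ} {k : ℝ} (hk : k ≠ 0) (hf0 : f ≠ 0)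
    (hf : laplacian G W *ᵥ f = k • f) : κ ≤ k := by
  rcases hκ with ⟨v, _, rfl⟩ | ⟨u, v, huv, ν, h0, h1, h, rfl⟩
  · -- Translate the eigenvector so that it vanishes at the characteristic-like vertex.
    refine one_div_le_of_translate hW hk hf0 hf (specRad_nonneg _) (c := blockAt f v) ?_
    refine SupportedOn.dotProduct_self_le hG.connected hW (v := v) (S := {v}ᶜ) (by simp) ?_
    rintro ⟨a, i⟩ ha
    obtain rfl : a = v := by simpa using ha
    simp [constVec, blockAt]
  · -- Translate the eigenvector so that its linear interpolation along `uv` vanishes at the point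
    -- dividing the edge as `ν : 1 - ν`.
    refine one_div_le_of_translate hW hk hf0 hf (specRad_nonneg _)
      (c := blockAt f u - ν • (blockAt f u - blockAt f v)) ?_
    set c := blockAt f u - ν • (blockAt f u - blockAt f v) with hc
    set y := f - constVec c with hy
    have hyu : blockAt y u = ν • (blockAt f u - blockAt f v) := by
      change blockAt f u - c = _
      rw [hc, sub_sub_cancel]
    have hyv : blockAt y v = -((1 - ν) • (blockAt f u - blockAt f v)) := by
      change blockAt f v - c = _
      rw [hc, sub_smul, one_smul]
      abel
    have hadj := huv.1.1
    have hA := (supportedOn_cut (branch G v u) y).dotProduct_self_le_shifted hG hW hadj.symm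
      (t := 1 - ν) (by linarith) (by linarith)
    have hB := (supportedOn_cut (branch G u v) y).dotProduct_self_le_shifted hG hW hadj h0.le h1
    rw [← h, sub_sub_cancel, Sym2.eq_swap, blockAt_cut, if_pos (mem_branch_self hadj.ne)] at hA
    rw [blockAt_cut, if_pos (mem_branch_self hadj.ne')] at hB
    rw [dotProduct_self_eq_add_cut hG hadj,
      dotProduct_laplacian_eq_add_cut hG hW hadj h0 h1 hyu hyv, mul_add]
    exact add_le_add hA hB

/-! ### The eigenvalue `λ_{s+1}` of the Laplacian -/

/-- The kernel of the Laplacian of a connected graph consists of the constant vectors. -/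
theorem finrank_ker_laplacian [Nonempty V] (hG : G.Connected)
    (hW : ∀ e ∈ G.edgeSet, (W e).PosDef) :
    Module.finrank ℝ (LinearMap.ker (laplacian G W).mulVecLin) = s := by
  let φ : (Fin s → ℝ) →ₗ[ℝ] (V × Fin s → ℝ) :=
    { toFun := constVec, map_add' := fun _ _ => rfl, map_smul' := fun _ _ => rfl }
  have hφ : Function.Injective φ := fun c c' h =>
    funext fun i => congrFun h (Classical.arbitrary V, i)
  have hker : LinearMap.ker (laplacian G W).mulVecLin = LinearMap.range φ := by
    ext f
    rw [LinearMap.mem_ker, LinearMap.mem_range, mulVecLin_apply]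
    constructor
    · intro h
      refine ⟨blockAt f (Classical.arbitrary V), ?_⟩
      ext ⟨a, i⟩
      exact congrFun (blockAt_eq_of_dotProduct_laplacian_eq_zero hG hW
        (by rw [h, dotProduct_zero]) (Classical.arbitrary V) a) i
    · rintro ⟨c, rfl⟩
      exact laplacian_mulVec_constVec c
  rw [hker, LinearMap.finrank_range_of_inj hφ, Module.finrank_fin_fun]

theorem count_zero_roots_charpoly {m : Type*} [Fintype m] [DecidableEq m] {A : Matrix m m ℝ}
    (hA : A.IsHermitian) :
    A.charpoly.roots.count 0 = Module.finrank ℝ (LinearMap.ker A.mulVecLin) := by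
  have h1 := LinearMap.finrank_range_add_finrank_ker A.mulVecLin
  have h2 : Module.finrank ℝ (LinearMap.range A.mulVecLin) = _ := hA.rank_eq_card_non_zero_eigs
  rw [h2, Module.finrank_fintype_fun_eq_card] at h1
  have h3 := Finset.card_filter_add_card_filter_not (s := (Finset.univ : Finset m))
    (fun i => hA.eigenvalues i = 0)
  rw [Finset.card_univ] at h3
  have h4 : A.charpoly.roots.count 0 =
      (Finset.univ.filter fun i => hA.eigenvalues i = 0).card := by
    rw [hA.roots_charpoly_eq_eigenvalues, Multiset.count_map]
    simp only [Function.comp, eq_comm (a := (0 : ℝ))]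
    rfl
  have h5 : Fintype.card {i // hA.eigenvalues i ≠ 0} =
      (Finset.univ.filter fun i => ¬ hA.eigenvalues i = 0).card := Fintype.card_subtype _
  omega

/-- In an increasing list of nonnegative numbers with `k` zeros, the entry following the first `k`
is the least nonzero one. -/
theorem getD_of_count_zero (l : List ℝ) (hl : l.Pairwise (· ≤ ·)) (hnn : ∀ x ∈ l, 0 ≤ x) {k : ℕ}
    (hk : l.count 0 = k) (hlen : k < l.length) :
    l.getD k 0 ∈ l ∧ l.getD k 0 ≠ 0 ∧ ∀ x ∈ l, x ≠ 0 → l.getD k 0 ≤ x := by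
  induction l generalizing k with
  | nil => simp at hlen
  | cons a t ih =>
    rw [List.pairwise_cons] at hl
    cases k with
    | zero =>
      have h0 : (0 : ℝ) ∉ a :: t := List.count_eq_zero.1 hk
      refine ⟨by simp, fun h => h0 (by simp at h; simp [h]), fun x hx _ => ?_⟩
      rcases List.mem_cons.1 hx with rfl | hx
      · simp
      · simpa using hl.1 x hx
    | succ k =>
      have ha : a = 0 := by
        by_contra ha
        have h0 : (0 : ℝ) ∈ t := by
          rw [List.count_cons_of_ne (fun h => ha h)] at hk
          exact List.count_pos_iff.1 (by omega)
        exact ha (le_antisymm (hl.1 0 h0) (hnn a (by simp)))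
      subst ha
      obtain ⟨h1, h2, h3⟩ := ih hl.2 (fun x hx => hnn x (List.mem_cons_of_mem _ hx))
        (by simpa using hk) (by simpa using hlen)
      simp only [List.getD_cons_succ]
      refine ⟨List.mem_cons_of_mem _ h1, h2, fun x hx hx0 => ?_⟩
      exact h3 x ((List.mem_cons.1 hx).resolve_left hx0) hx0

theorem isLeast_mu [Nontrivial V] (hG : G.Connected) (hW : ∀ e ∈ G.edgeSet, (W e).PosDef)
    (hs : 1 ≤ s) : IsLeast {x : ℝ | x ∈ spectrum ℝ (laplacian G W) ∧ x ≠ 0} (mu G W) := by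
  have hP := posSemidef_laplacian hW
  have hmem : ∀ x, x ∈ (laplacian G W).charpoly.roots.sort (· ≤ ·) ↔
      x ∈ spectrum ℝ (laplacian G W) := fun x => by
    rw [Multiset.mem_sort, Polynomial.mem_roots (charpoly_monic _).ne_zero,
      mem_spectrum_iff_isRoot_charpoly]
  have hcount : ((laplacian G W).charpoly.roots.sort (· ≤ ·)).count 0 = s := by
    rw [← Multiset.coe_count, Multiset.sort_eq, count_zero_roots_charpoly hP.1,
      finrank_ker_laplacian hG hW]
  have hlen : s < ((laplacian G W).charpoly.roots.sort (· ≤ ·)).length := by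
    rw [Multiset.length_sort, hP.1.roots_charpoly_eq_eigenvalues, Multiset.card_map,
      Finset.card_val, Finset.card_univ, Fintype.card_prod, Fintype.card_fin]
    have := Fintype.one_lt_card (α := V)
    nlinarith
  obtain ⟨h1, h2, h3⟩ := getD_of_count_zero _ (Multiset.pairwise_sort _ _) (fun x hx => by
    rw [hmem, hP.1.spectrum_real_eq_range_eigenvalues] at hx
    obtain ⟨i, rfl⟩ := hx
    exact hP.eigenvalues_nonneg i) hcount hlen
  exact ⟨⟨(hmem _).1 h1, h2⟩, fun x hx => h3 x ((hmem x).2 hx.1) hx.2⟩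

theorem IsKappa.le_mu [Nontrivial V] (hG : G.IsTree) (hW : ∀ e ∈ G.edgeSet, (W e).PosDef)
    (hs : 1 ≤ s) {κ : ℝ} (hκ : IsKappa G W κ) : κ ≤ mu G W := by
  obtain ⟨hmem, hne⟩ := (isLeast_mu hG.connected hW hs).1
  rw [← spectrum_toLin'] at hmem
  obtain ⟨f, hf⟩ := (Module.End.hasEigenvalue_iff_mem_spectrum.2 hmem).exists_hasEigenvector
  exact hκ.le_of_eigenvector hG hW hne hf.2 (by simpa using hf.apply_eq_smul)

end Kappa

end MatrixTree

theorem mainTheorem1 {V : Type*} [Fintype V] [DecidableEq V] [Nontrivial V]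
    (T : SimpleGraph V) [DecidableRel T.Adj] (hT : T.IsTree)
    (s : ℕ) (hs : 1 ≤ s) (W : Sym2 V → Matrix (Fin s) (Fin s) ℝ)
    (hW : ∀ e ∈ T.edgeSet, (W e).PosDef) :
    -- `μ(T) = λ_{s+1}(L(T))` is the smallest non-zero eigenvalue of `L(T)`
    IsLeast {x : ℝ | x ∈ spectrum ℝ (MatrixTree.laplacian T W) ∧ x ≠ 0} (MatrixTree.mu T W) ∧
    -- the constant `κ(T)` is well defined
    (∃! κ : ℝ, MatrixTree.IsKappa T W κ) ∧
    -- `κ(T) ≤ μ(T)`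
    (∀ κ : ℝ, MatrixTree.IsKappa T W κ → κ ≤ MatrixTree.mu T W) := by
  obtain ⟨κ, hκ⟩ := MatrixTree.exists_isKappa hT hW hs
  exact ⟨MatrixTree.isLeast_mu hT.connected hW hs, ⟨κ, hκ, fun _ h => h.unique hT hW hs hκ⟩,
    fun _ h => h.le_mu hT hW hs⟩
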